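/- **Model.** A network is a connected undirected graph $G$ on $n$ nodes with pairwise distinct integer IDs from a polynomial range $\{0,\dots,n^k-1\}$, $k\ge 1$. The nodes communicate in synchronous rounds over the edges of $G$. For $\rho\ge 1$, the assumption $\mathsf{KT}_\rho$ means that every node $x$ initially knows its $\rho$-neighborhood: the IDs of all nodes at distance at most $\rho$ from $x$ and all edges between such nodes, except those between two nodes at distance exactly $\rho$. In addition, all nodes know $n$ exactly. An algorithm is *comparison-based* if every node has ID variables and ordinary variables, the only operation on ID variables, apart from sending and storing them, is to compare them, and the local computation on ordinary variables (including results of comparisons and private unbiased random bits) is arbitrary. Each message may contain at most $B=O(1)$ IDs, besides ordinary content. **Problem.** For a real number $d$, the input is a network $G$ with a designated root $u_0$ and an arbitrary directed subgraph $T$ of $G$; root and edge directions are visible to the nodes in whose $\rho$-neighborhood they lie. The subgraph $T$ is a *$d$-approximate BFS tree* if it is a spanning tree of $G$ directed away from $u_0$ and $\mathrm{dist}_T(u_0,v)\le d\cdot \mathrm{dist}_G(u_0,v)$ for all nodes $v$. Every node must eventually output accept or reject. If $T$ is a $d$-approximate BFS tree then all nodes must accept, and otherwise at least one node must reject ($\mathsf{One}$-$\mathsf{Detects}$).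 An algorithm is an *$\epsilon$-error* algorithm if on every input its outputs are correct with probability at least $1-\epsilon$. Its message complexity on an input is the expected total number of messages sent. **Theorem.** There is a constant $c>0$ such that, for all constants $0<\beta<1$, $0<\epsilon<\frac14$ and $B$, there are $C>0$ and $n_0$ with the following property. Let $n\ge n_0$, let $\rho\ge1$ and $k \ge 1$ be integers, and let $d$ be a real number with $$\frac{3\rho-1}{\rho+1}\le d\le\frac{(1-\beta)n}{4\rho-2}.$$ For every $\epsilon$-error randomized comparison-based algorithm that solves $d$-approximate BFS tree verification with the $\mathsf{One}$-$\mathsf{Detects}$ guarantee on all $n$-node networks under the $\mathsf{KT}_\rho$ assumption, there is an $n$-node network (with input) on which its message complexity is at least $$C\cdot\frac1\rho\left(\frac n\rho\right)^{1+\frac c\rho},$$ and, if $\rho=1$, also at least $C n^2$. -/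

import Mathlib

open scoped ENNReal
open MeasureTheory

/-! ### Networks, inputs, and the verification problem -/

/-- An input of the `d`-approximate BFS verification problem on `n` nodes: a connected network with
unique node identifiers, a designated root, and an arbitrary directed subgraph of the network
(`tree p v` means that the edge from the parent `p` to the child `v` is labelled). -/
structure BFSInput (n : ℕ) where
  graph : SimpleGraph (Fin n)
  connected : graph.Connected
  id : Fin n → ℕ
  id_injective : Function.Injective id
  root : Fin n
  tree : Fin n → Fin n → Prop
  tree_adj : ∀ p v, tree p v → graph.Adj p v

namespace BFSInput

variable {n : ℕ}

/-- The labelled subgraph with directions forgotten. -/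
def treeGraph (I : BFSInput n) : SimpleGraph (Fin n) := SimpleGraph.fromRel I.tree

/-- The labelled subgraph is a spanning tree of the network, directed away from the root, in which
the distance from the root to every node is at most `d` times the distance in the network. -/
def IsApproxBFSTree (I : BFSInput n) (d : ℝ) : Prop :=
  I.treeGraph.IsTree ∧
  (∀ p v, I.tree p v → I.treeGraph.dist I.root v = I.treeGraph.dist I.root p + 1) ∧
  ∀ v, (I.treeGraph.dist I.root v : ℝ) ≤ d * (I.graph.dist I.root v : ℝ)

open Classical in
/-- The nodes within distance `ρ` of `x`, listed by increasing identifier. The position of a node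
in this list is called its slot at `x`. -/
noncomputable def known (I : BFSInput n) (ρ : ℕ) (x : Fin n) : List (Fin n) :=
  ((List.finRange n).filter fun y => I.graph.dist x y ≤ ρ).insertionSort
    fun y z => I.id y ≤ I.id z

/-- The edge set of the `ρ`-neighborhood of `x`: the edges between nodes within distance `ρ` of `x`,
except those between two nodes that are both at distance exactly `ρ`. -/
def nbhdAdj (I : BFSInput n) (ρ : ℕ) (x y z : Fin n) : Prop :=
  I.graph.Adj y z ∧ I.graph.dist x y ≤ ρ ∧ I.graph.dist x z ≤ ρ ∧
    ¬ (I.graph.dist x y = ρ ∧ I.graph.dist x z = ρ)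

end BFSInput

/-- The ordinary (identifier-free) part of the initial knowledge of a node. Known nodes are referred
to by their slots, so this records exactly the labelled `ρ`-neighborhood up to order-equivalence. -/
structure LocalView where
  /-- the exact number of nodes of the network -/
  networkSize : ℕ
  /-- the number of nodes within distance `ρ` -/
  knownCount : ℕ
  /-- the slot of the node itself -/
  self : ℕ
  /-- the edges of the `ρ`-neighborhood -/
  adj : ℕ → ℕ → Prop
  /-- the directed labelled edges of the `ρ`-neighborhood -/
  tree : ℕ → ℕ → Prop
  /-- which known node, if any, is the root -/
  isRoot : ℕ → Prop

/-- The view of `x` at the start, under the `KT_ρ` assumption. -/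
noncomputable def BFSInput.view {n : ℕ} (I : BFSInput n) (ρ : ℕ) (x : Fin n) : LocalView where
  networkSize := n
  knownCount := (I.known ρ x).length
  self := (I.known ρ x).idxOf x
  adj i j := ∃ y z, (I.known ρ x)[i]? = some y ∧ (I.known ρ x)[j]? = some z ∧ I.nbhdAdj ρ x y z
  tree i j := ∃ y z, (I.known ρ x)[i]? = some y ∧ (I.known ρ x)[j]? = some z ∧
    I.nbhdAdj ρ x y z ∧ I.tree y z
  isRoot i := (I.known ρ x)[i]? = some I.root

/-! ### Comparison-based algorithms -/

/-- The results of all pairwise comparisons of a list of ID variables. -/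
def comparisons (ids : List ℕ) : List (List Ordering) :=
  ids.map fun a => ids.map fun b => compare a b

/-- A randomized comparison-based algorithm whose messages carry at most `B` identifiers.

A node holds a list of ID variables and an ordinary state. Its computation sees of the ID variables
only the results of their pairwise comparisons. Each node has a private tape of random bits.
The ordinary state and the ordinary content of a message are otherwise unrestricted finite data. -/
structure ComparisonAlgorithm (B : ℕ) where
  /-- values of the ordinary variables -/
  State : Type
  /-- ordinary contents of messages -/
  Content : Type
  countable_state : Countable State
  countable_content : Countable Content
  /-- the ordinary state at the start, from the initial knowledge and the random tape -/
  init : LocalView → (ℕ → Bool) → State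
  /-- the message, if any, to the neighbor with a given slot: an ordinary content, and the indices
  of the ID variables whose values are attached -/
  send : State → List (List Ordering) → ℕ → Option (Content × List ℕ)
  send_length : ∀ s t i m, send s t i = some m → m.2.length ≤ B
  /-- the state transition at the end of a round, from the old state, the comparisons of all ID
  variables (the received ones are appended at the end), the received messages in the order of the
  slots of their senders, each given as (slot of the sender, content, number of attached
  identifiers), and the random tape -/
  next : State → List (List Ordering) → List (ℕ × Content × ℕ) → (ℕ → Bool) → State
  /-- the output of a node, once it has decided: `true` is accept and `false` is reject -/
  output : State → Option Bool
  measurable_init : ∀ v, @Measurable (ℕ → Bool) State MeasurableSpace.pi ⊤ (init v)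
  measurable_next : ∀ s t m, @Measurable (ℕ → Bool) State MeasurableSpace.pi ⊤ (next s t m)

/-- The law of the private random bits: all bits of all nodes are fair and independent. -/
noncomputable def coins (n : ℕ) : Measure (Fin n × ℕ → Bool) :=
  Measure.infinitePi fun _ => (PMF.uniformOfFintype Bool).toMeasure

namespace ComparisonAlgorithm

variable {B n : ℕ}

/-- The state of a node: its ID variables and its ordinary state. -/
structure NodeState (A : ComparisonAlgorithm B) where
  ids : List ℕ
  ordinary : A.State

open Classical in
/-- The message that `y` sends to `x` if the nodes are in the states `c`: content and
identifiers. -/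
noncomputable def message (A : ComparisonAlgorithm B) (I : BFSInput n) (ρ : ℕ)
    (c : Fin n → A.NodeState) (y x : Fin n) : Option (A.Content × List ℕ) :=
  if I.graph.Adj y x then
    (A.send (c y).ordinary (comparisons (c y).ids) ((I.known ρ y).idxOf x)).map
      fun m => (m.1, m.2.filterMap fun i => (c y).ids[i]?)
  else none

/-- The messages that `x` receives, in the order of the slots of their senders: slot of the
sender, content, identifiers. -/
noncomputable def inbox (A : ComparisonAlgorithm B) (I : BFSInput n) (ρ : ℕ)
    (c : Fin n → A.NodeState) (x : Fin n) : List (ℕ × A.Content × List ℕ) :=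
  (I.known ρ x).filterMap fun y =>
    (A.message I ρ c y x).map fun m => ((I.known ρ x).idxOf y, m.1, m.2)

/-- The states of the nodes after `r` synchronous rounds, with random bits `ω`. -/
noncomputable def run (A : ComparisonAlgorithm B) (I : BFSInput n) (ρ : ℕ)
    (ω : Fin n × ℕ → Bool) : ℕ → Fin n → A.NodeState
  | 0 => fun x => ⟨(I.known ρ x).map I.id, A.init (I.view ρ x) fun i => ω (x, i)⟩
  | r + 1 => fun x =>
      let c := A.run I ρ ω r
      let received := A.inbox I ρ c x
      let ids := (c x).ids ++ received.flatMap fun m => m.2.2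
      ⟨ids, A.next (c x).ordinary (comparisons ids)
        (received.map fun m => (m.1, m.2.1, m.2.2.length)) fun i => ω (x, i)⟩

/-- Node `x` eventually outputs `b`; the first output of a node is final. -/
def Outputs (A : ComparisonAlgorithm B) (I : BFSInput n) (ρ : ℕ) (ω : Fin n × ℕ → Bool)
    (x : Fin n) (b : Bool) : Prop :=
  ∃ r, A.output (A.run I ρ ω r x).ordinary = some b ∧
    ∀ s < r, A.output (A.run I ρ ω s x).ordinary = none

/-- The outcome is correct for `d`-approximate BFS verification with the One-Detects guarantee:
every node decides; on a legal input all nodes accept, on an illegal one at least one rejects. -/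
def Correct (A : ComparisonAlgorithm B) (I : BFSInput n) (ρ : ℕ) (d : ℝ)
    (ω : Fin n × ℕ → Bool) : Prop :=
  (∀ x, ∃ b, A.Outputs I ρ ω x b) ∧
  (I.IsApproxBFSTree d → ∀ x, A.Outputs I ρ ω x true) ∧
  (¬ I.IsApproxBFSTree d → ∃ x, A.Outputs I ρ ω x false)

/-- The algorithm solves `d`-approximate BFS verification with One-Detects and error at most `ε`
under `KT_ρ`, on all `n`-node networks with identifiers below `n ^ k`. -/
def Solves (A : ComparisonAlgorithm B) (n k ρ : ℕ) (d ε : ℝ) : Prop :=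
  ∀ I : BFSInput n, (∀ x, I.id x < n ^ k) →
    ENNReal.ofReal (1 - ε) ≤ coins n {ω | A.Correct I ρ d ω}

open Classical in
/-- The number of messages sent in the whole execution. -/
noncomputable def messageCount (A : ComparisonAlgorithm B) (I : BFSInput n) (ρ : ℕ)
    (ω : Fin n × ℕ → Bool) : ℝ≥0∞ :=
  ∑' r : ℕ, ((Finset.univ.filter fun p : Fin n × Fin n =>
    (A.message I ρ (A.run I ρ ω r) p.1 p.2).isSome).card : ℝ≥0∞)

/-- The expected number of messages on input `I`. -/
noncomputable def expectedMessages (A : ComparisonAlgorithm B) (I : BFSInput n) (ρ : ℕ) : ℝ≥0∞ :=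
  ∫⁻ ω, A.messageCount I ρ ω ∂ coins n

end ComparisonAlgorithm

/-! The lower bound follows from a crossing argument.

Consider two copies of a graph, and replace the two copies `u₀v₀`, `u₁v₁` of one of its edges by
`u₀v₁` and `u₁v₀`. If the edge lies on no cycle of length at most `2 * ρ`, and corresponding nodes
have consecutive identifiers, then every node has the same initial view before and after the
crossing, up to order-equivalence (`IsTwin.view_eq`): a node near `u₀` merely knows `v₁` and its
surroundings in place of `v₀` and its surroundings. Hence the executions of a comparison-based
algorithm on both networks correspond to each other, unless a message travels along the edge, or
a node sends or receives the identifier of a node whose role has changed for it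
(`ComparisonAlgorithm.statesMatch_run`). A message with `B` identifiers has this effect on at most
`1 + 4 * B * ρ` edges, because the edges concerned by a given pair of nodes all lie on one shortest
path (`card_nearAcross_le`). So if each of `m` crossings changes the correct answer, then each is
noticed with probability at least one half, and at least `m / (2 * (1 + 4 * B * ρ))` messages are
sent in expectation (`ComparisonAlgorithm.card_le_expectedMessages`).

The network consists of two spiders with `N` legs of length `ρ`, whose centers are joined by a long
path; the root is the center of the first one. This tree is the labelled subgraph. The tips of both
spiders are joined according to a graph `H` without cycles of length at most `2 * ρ`. The labelled
tree is a BFS tree, as edges between tips join nodes of equal depth. After crossing an edge, a tip of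
the second spider is adjacent to one of the first, so that its distance from the root drops to
`ρ + 1`, while it remains large in the tree (`SpiderNode.exists_input_card_le`).

For `ρ = 1` the graph `H` is complete. In general it is a maximal graph of bounded degree without
short cycles, or a tree, and it has at least `N ^ (1 + 1 / (2 * ρ)) / 24` edges
(`SimpleGraph.exists_noShortCycle`). The constant `c` is `1 / 2`. -/

/-! ### Distances and 1-Lipschitz functions -/

/-- A function that grows by at most one along every edge bounds distances from below. -/
lemma SimpleGraph.Connected.le_add_dist {V : Type*} {G : SimpleGraph V} (hG : G.Connected)
    {f : V → ℕ} (hf : ∀ x y, G.Adj x y → f y ≤ f x + 1) (x y : V) :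
    f y ≤ f x + G.dist x y := by
  obtain ⟨p, hp⟩ := hG.exists_walk_length_eq_dist x y
  rw [← hp]
  clear hp
  induction p with
  | nil => simp
  | cons h p ih =>
    have := hf _ _ h
    rw [SimpleGraph.Walk.length_cons]
    omega

lemma SimpleGraph.Connected.dist_le_dist_add_one {V : Type*} {G : SimpleGraph V}
    (hG : G.Connected) (x : V) {y z : V} (h : G.Adj y z) : G.dist x z ≤ G.dist x y + 1 := by
  have h1 := hG.dist_triangle (u := x) (v := y) (w := z)
  rw [SimpleGraph.dist_eq_one_iff_adj.2 h] at h1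
  exact h1

/-- A vertex at distance at most `r + 1` is adjacent to a vertex at distance at most `r`, unless
it is at distance at most `r` itself. -/
lemma SimpleGraph.Connected.exists_adj_dist_le {V : Type*} {G : SimpleGraph V}
    (hG : G.Connected) {x z : V} {r : ℕ} (h : G.dist x z ≤ r + 1) (h' : ¬ G.dist x z ≤ r) :
    ∃ y, G.dist x y ≤ r ∧ G.Adj y z := by
  obtain ⟨p, hp⟩ := hG.exists_walk_length_eq_dist z x
  rw [G.dist_comm] at hp
  cases p with
  | nil => simp at h'
  | @cons _ y _ hadj q =>
    refine ⟨y, ?_, hadj.symm⟩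
    have := G.dist_le q
    rw [SimpleGraph.Walk.length_cons] at hp
    rw [G.dist_comm]
    omega

/-! ### Crossing a pair of edges -/

/-- The situation in which edges can be crossed. `F` is a graph with an involutive automorphism
`σ`. The relation `R` is a set of extra edges that is a matching, is invariant under `σ`, and whose
end points have pairwise distance at least `2 * ρ` in `F`. Crossing replaces the extra edges
`R a b` by the edges `R a (σ b)`. -/
structure IsCrossing {V : Type*} (F : SimpleGraph V) (σ : V → V) (R : V → V → Prop) (ρ : ℕ) :
    Prop where
  connected : F.Connected
  pos : 1 ≤ ρ
  invol : ∀ x, σ (σ x) = x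
  adj : ∀ x y, F.Adj x y → F.Adj (σ x) (σ y)
  symm : ∀ a b, R a b → R b a
  equivariant : ∀ a b, R a b → R (σ a) (σ b)
  unique : ∀ a b c, R a b → R a c → b = c
  ne : ∀ a b, R a b → a ≠ b
  ne_swap : ∀ a b, R a b → a ≠ σ b
  ne_self : ∀ a b, R a b → a ≠ σ a
  far : ∀ a b c d, R a b → R c d → a ≠ c → 2 * ρ ≤ F.dist a c

/-- There is a path of length at most `ρ` from `x` to `z` through exactly one extra edge. -/
def NearAcross {V : Type*} (F : SimpleGraph V) (R : V → V → Prop) (ρ : ℕ) (x z : V) : Prop :=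
  ∃ a b, R a b ∧ F.dist x a + 1 + F.dist b z ≤ ρ

/-- The nodes that are near `x` across an extra edge, before or after the crossing. These are the
nodes whose identity, as seen from `x`, is changed by the crossing. -/
def Affected {V : Type*} (F : SimpleGraph V) (σ : V → V) (R : V → V → Prop) (ρ : ℕ) (x z : V) :
    Prop :=
  NearAcross F R ρ x z ∨ NearAcross F R ρ x (σ z)

open Classical in
/-- The node that takes the place of `z` in the knowledge of `x` after the crossing. -/
noncomputable def substitute {V : Type*} (F : SimpleGraph V) (σ : V → V) (R : V → V → Prop)
    (ρ : ℕ) (x z : V) : V :=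
  if Affected F σ R ρ x z then σ z else z

namespace IsCrossing

variable {V : Type*} {F : SimpleGraph V} {σ : V → V} {R : V → V → Prop} {ρ : ℕ}

lemma injective (h : IsCrossing F σ R ρ) : Function.Injective σ :=
  (show Function.Involutive σ from h.invol).injective

lemma dist_le (h : IsCrossing F σ R ρ) (x y : V) : F.dist (σ x) (σ y) ≤ F.dist x y := by
  obtain ⟨p, hp⟩ := h.connected.exists_walk_length_eq_dist x y
  have := F.dist_le (p.map (⟨σ, fun hxy => h.adj _ _ hxy⟩ : F →g F))
  rw [SimpleGraph.Walk.length_map, hp] at this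
  exact this

lemma dist_eq (h : IsCrossing F σ R ρ) (x y : V) : F.dist (σ x) (σ y) = F.dist x y := by
  refine le_antisymm (h.dist_le x y) ?_
  simpa [h.invol] using h.dist_le (σ x) (σ y)

/-- Crossing is an involution. -/
lemma swap (h : IsCrossing F σ R ρ) : IsCrossing F σ (fun a b => R a (σ b)) ρ where
  connected := h.connected
  pos := h.pos
  invol := h.invol
  adj := h.adj
  symm a b hab := by simpa [h.invol] using h.equivariant _ _ (h.symm _ _ hab)
  equivariant a b hab := h.equivariant _ _ hab
  unique a b c hb hc := h.injective (h.unique _ _ _ hb hc)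
  ne a b hab := by simpa [h.invol] using h.ne_swap _ _ hab
  ne_swap a b hab := h.ne _ _ hab
  ne_self a b hab := h.ne_self _ _ hab
  far a b c d hab hcd := h.far _ _ _ _ hab hcd

lemma nearAcross_swap (h : IsCrossing F σ R ρ) (x z : V) :
    NearAcross F (fun a b => R a (σ b)) ρ x z ↔ NearAcross F R ρ x (σ z) := by
  constructor
  · rintro ⟨a, b, hab, hd⟩
    exact ⟨a, σ b, hab, by rwa [h.dist_eq]⟩
  · rintro ⟨a, b, hab, hd⟩
    refine ⟨a, σ b, by simpa [h.invol] using hab, ?_⟩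
    rwa [← h.dist_eq (σ b) z, h.invol]

lemma affected_swap (h : IsCrossing F σ R ρ) (x z : V) :
    Affected F σ (fun a b => R a (σ b)) ρ x z ↔ Affected F σ R ρ x z := by
  rw [Affected, Affected, h.nearAcross_swap, h.nearAcross_swap, h.invol, or_comm]

lemma affected_map (h : IsCrossing F σ R ρ) (x z : V) :
    Affected F σ R ρ x (σ z) ↔ Affected F σ R ρ x z := by
  rw [Affected, Affected, h.invol, or_comm]

lemma substitute_of_affected {x z : V} (hz : Affected F σ R ρ x z) :
    substitute F σ R ρ x z = σ z := by
  simp [substitute, hz]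

lemma substitute_of_not_affected {x z : V} (hz : ¬ Affected F σ R ρ x z) :
    substitute F σ R ρ x z = z := by
  simp [substitute, hz]

lemma substitute_swap (h : IsCrossing F σ R ρ) (x z : V) :
    substitute F σ (fun a b => R a (σ b)) ρ x z = substitute F σ R ρ x z := by
  by_cases hz : Affected F σ R ρ x z
  · rw [substitute_of_affected hz, substitute_of_affected ((h.affected_swap x z).2 hz)]
  · rw [substitute_of_not_affected hz,
      substitute_of_not_affected (mt (h.affected_swap x z).1 hz)]

lemma substitute_substitute (h : IsCrossing F σ R ρ) (x z : V) :
    substitute F σ R ρ x (substitute F σ R ρ x z) = z := by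
  by_cases hz : Affected F σ R ρ x z
  · rw [substitute_of_affected hz, substitute_of_affected ((h.affected_map _ _).2 hz), h.invol]
  · rw [substitute_of_not_affected hz, substitute_of_not_affected hz]

lemma substitute_injective (h : IsCrossing F σ R ρ) (x : V) :
    Function.Injective (substitute F σ R ρ x) :=
  (show Function.Involutive _ from h.substitute_substitute x).injective

/-- A node that is near `x` across an extra edge is far from `x` without it, as the extra edge
lies on no short cycle. -/
lemma not_dist_le_of_nearAcross (h : IsCrossing F σ R ρ) {x z : V}
    (hz : NearAcross F R ρ x z) : ¬ F.dist x z ≤ ρ := by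
  obtain ⟨a, b, hab, hd⟩ := hz
  intro hxz
  have h1 := h.far _ _ _ _ hab (h.symm _ _ hab) (h.ne _ _ hab)
  have h2 := h.connected.dist_triangle (u := a) (v := x) (w := b)
  have h3 := h.connected.dist_triangle (u := x) (v := z) (w := b)
  rw [F.dist_comm (u := a) (v := x)] at h2
  rw [F.dist_comm (u := z) (v := b)] at h3
  omega

lemma not_affected_of_dist_le (h : IsCrossing F σ R ρ) {x z : V} (hz : F.dist x z ≤ ρ) :
    ¬ Affected F σ R ρ x z := by
  rintro (h1 | h1)
  · exact h.not_dist_le_of_nearAcross h1 hz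
  · exact h.swap.not_dist_le_of_nearAcross ((h.nearAcross_swap _ _).2 h1) hz

lemma not_nearAcross_map (h : IsCrossing F σ R ρ) {x z : V} (hz : NearAcross F R ρ x z) :
    ¬ NearAcross F R ρ x (σ z) := by
  obtain ⟨a, b, hab, hd⟩ := hz
  rintro ⟨c, d, hcd, hd'⟩
  have hac : a = c := by
    by_contra hac
    have h1 := h.far _ _ _ _ hab hcd hac
    have h2 := h.connected.dist_triangle (u := a) (v := x) (w := c)
    rw [F.dist_comm (u := a) (v := x)] at h2
    omega
  subst hac
  obtain rfl := h.unique _ _ _ hab hcd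
  have hb := h.symm _ _ hab
  have h1 := h.far _ _ _ _ hb (h.equivariant _ _ hb) (h.ne_self _ _ hb)
  have h2 := h.connected.dist_triangle (u := b) (v := σ z) (w := σ b)
  have h3 := h.dist_eq z b
  rw [F.dist_comm (u := z)] at h3
  omega

variable {G : SimpleGraph V}

lemma dist_le_dist (h : IsCrossing F σ R ρ) (hG : ∀ x y, G.Adj x y ↔ F.Adj x y ∨ R x y)
    (x y : V) : G.dist x y ≤ F.dist x y :=
  (h.connected x y).dist_anti (fun _ _ hab => (hG _ _).2 (Or.inl hab))

/-- Up to radius `ρ`, a shortest path of the whole graph uses at most one extra edge. -/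
lemma dist_le_iff (h : IsCrossing F σ R ρ) (hG : ∀ x y, G.Adj x y ↔ F.Adj x y ∨ R x y)
    (x z : V) {r : ℕ} (hr : r ≤ ρ) :
    G.dist x z ≤ r ↔ F.dist x z ≤ r ∨ ∃ a b, R a b ∧ F.dist x a + 1 + F.dist b z ≤ r := by
  have hconn : G.Connected := h.connected.mono fun _ _ hab => (hG _ _).2 (Or.inl hab)
  constructor
  · induction r generalizing z with
    | zero =>
      intro h0
      rw [Nat.le_zero, hconn.dist_eq_zero_iff] at h0
      simp [h0]
    | succ r ih =>
      intro hz
      by_cases hz' : G.dist x z ≤ r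
      · rcases ih z (by omega) hz' with h1 | ⟨a, b, hab, h1⟩
        · exact Or.inl (by omega)
        · exact Or.inr ⟨a, b, hab, by omega⟩
      · obtain ⟨y, hy, hyz⟩ := hconn.exists_adj_dist_le hz hz'
        rcases ih y (by omega) hy with h1 | ⟨a, b, hab, h1⟩
        · rcases (hG _ _).1 hyz with h2 | h2
          · have := h.connected.dist_le_dist_add_one x h2
            exact Or.inl (by omega)
          · exact Or.inr ⟨y, z, h2, by simp; omega⟩
        · rcases (hG _ _).1 hyz with h2 | h2
          · have := h.connected.dist_le_dist_add_one b h2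
            exact Or.inr ⟨a, b, hab, by omega⟩
          · have hby : b = y := by
              by_contra hby
              have := h.far _ _ _ _ (h.symm _ _ hab) h2 hby
              omega
            subst hby
            obtain rfl := h.unique _ _ _ (h.symm _ _ hab) h2
            exact Or.inl (by omega)
  · rintro (h1 | ⟨a, b, hab, h1⟩)
    · exact (h.dist_le_dist hG x z).trans h1
    · have h2 := h.dist_le_dist hG x a
      have h3 := h.dist_le_dist hG b z
      have h4 := hconn.dist_triangle (u := x) (v := a) (w := z)
      have h5 := hconn.dist_triangle (u := a) (v := b) (w := z)
      have h6 : G.dist a b = 1 := SimpleGraph.dist_eq_one_iff_adj.2 ((hG _ _).2 (Or.inr hab))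
      omega

/-- Among the nodes that `x` knows, the affected ones are those near `x` across an extra edge. -/
lemma nearAcross_of_affected (h : IsCrossing F σ R ρ)
    (hG : ∀ x y, G.Adj x y ↔ F.Adj x y ∨ R x y) {x z : V} (hz : G.dist x z ≤ ρ)
    (ha : Affected F σ R ρ x z) : NearAcross F R ρ x z := by
  rcases (h.dist_le_iff hG x z le_rfl).1 hz with h1 | h1
  · exact absurd ha (h.not_affected_of_dist_le h1)
  · exact h1

lemma dist_substitute_le (h : IsCrossing F σ R ρ) {G' : SimpleGraph V}
    (hG : ∀ x y, G.Adj x y ↔ F.Adj x y ∨ R x y)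
    (hG' : ∀ x y, G'.Adj x y ↔ F.Adj x y ∨ R x (σ y)) {x z : V} {r : ℕ} (hr : r ≤ ρ)
    (hz : G.dist x z ≤ r) : G'.dist x (substitute F σ R ρ x z) ≤ r := by
  rw [h.swap.dist_le_iff hG' _ _ hr]
  rcases (h.dist_le_iff hG x z hr).1 hz with h1 | ⟨a, b, hab, h1⟩
  · rw [substitute_of_not_affected (h.not_affected_of_dist_le (h1.trans hr))]
    exact Or.inl h1
  · rw [substitute_of_affected (Or.inl ⟨a, b, hab, h1.trans hr⟩)]
    exact Or.inr ⟨a, σ b, by simpa [h.invol] using hab, by rwa [h.dist_eq]⟩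

end IsCrossing

/-! ### Crossed inputs and the initial knowledge -/

/-- The inputs `I` and `I'` arise from each other by crossing the extra edges `R`. All nodes that
take part in a substitution lie in `S`, where `σ` shifts identifiers by one and preserves the
labelled subgraph. -/
structure IsTwin {n : ℕ} (I I' : BFSInput n) (F : SimpleGraph (Fin n)) (σ : Fin n → Fin n)
    (R : Fin n → Fin n → Prop) (S : Set (Fin n)) (ρ : ℕ) : Prop
    extends IsCrossing F σ R ρ where
  graph_adj : ∀ x y, I.graph.Adj x y ↔ F.Adj x y ∨ R x y
  graph_adj' : ∀ x y, I'.graph.Adj x y ↔ F.Adj x y ∨ R x (σ y)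
  id_eq : I'.id = I.id
  root_eq : I'.root = I.root
  tree_eq : I'.tree = I.tree
  tree_le : ∀ y z, I.tree y z → F.Adj y z
  mem_of_dist_lt : ∀ a b y, R a b → F.dist b y < ρ → y ∈ S
  map_mem : ∀ y, y ∈ S → σ y ∈ S
  id_map : ∀ y, y ∈ S → I.id (σ y) = I.id y + 1 ∨ I.id y = I.id (σ y) + 1
  tree_map : ∀ y z, y ∈ S → z ∈ S → (I.tree (σ y) (σ z) ↔ I.tree y z)
  root_notMem : I.root ∉ S

namespace BFSInput

variable {n : ℕ} (I : BFSInput n) (ρ : ℕ) (x : Fin n)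

lemma mem_known {y : Fin n} : y ∈ I.known ρ x ↔ I.graph.dist x y ≤ ρ := by
  simp [known, List.mem_insertionSort]

lemma nodup_known : (I.known ρ x).Nodup := by
  rw [known, (List.perm_insertionSort _ _).nodup_iff]
  exact (List.nodup_finRange n).filter _

lemma pairwise_known : (I.known ρ x).Pairwise fun y z => I.id y ≤ I.id z := by
  have : Std.Total (fun y z : Fin n => I.id y ≤ I.id z) := ⟨fun a b => le_total _ _⟩
  have : IsTrans (Fin n) (fun y z : Fin n => I.id y ≤ I.id z) := ⟨fun a b c => le_trans⟩
  exact List.pairwise_insertionSort _ _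

/-- A list of the right members that is sorted by identifier is the list of known nodes. -/
lemma known_eq_of_pairwise {l : List (Fin n)} (hl : l.Nodup)
    (hs : l.Pairwise fun y z => I.id y ≤ I.id z)
    (hm : ∀ y, y ∈ l ↔ I.graph.dist x y ≤ ρ) : I.known ρ x = l := by
  refine List.Perm.eq_of_pairwise (le := fun y z => I.id y ≤ I.id z) ?_
    (I.pairwise_known ρ x) hs ?_
  · intro a b _ _ hab hba
    exact I.id_injective (le_antisymm hab hba)
  · exact (List.perm_ext_iff_of_nodup (I.nodup_known ρ x) hl).2
      fun y => by rw [I.mem_known, hm]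

end BFSInput

lemma List.idxOf_map_of_injective {α β : Type*} [BEq α] [LawfulBEq α] [BEq β] [LawfulBEq β]
    {f : α → β} (hf : Function.Injective f) (l : List α) (a : α) :
    (l.map f).idxOf (f a) = l.idxOf a := by
  induction l with
  | nil => rfl
  | cons b l ih =>
    by_cases hab : b = a
    · subst hab; simp
    · rw [List.map_cons, List.idxOf_cons_ne _ hab, List.idxOf_cons_ne _ (hf.ne hab), ih]

namespace IsTwin

variable {n : ℕ} {I I' : BFSInput n} {F : SimpleGraph (Fin n)} {σ : Fin n → Fin n}
  {R : Fin n → Fin n → Prop} {S : Set (Fin n)} {ρ : ℕ}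

lemma flip (h : IsTwin I I' F σ R S ρ) : IsTwin I' I F σ (fun a b => R a (σ b)) S ρ where
  toIsCrossing := h.toIsCrossing.swap
  graph_adj := h.graph_adj'
  graph_adj' x y := by simpa [h.invol] using h.graph_adj x y
  id_eq := h.id_eq.symm
  root_eq := h.root_eq.symm
  tree_eq := h.tree_eq.symm
  tree_le := by rw [h.tree_eq]; exact h.tree_le
  mem_of_dist_lt a b y hab hy := by
    have := h.mem_of_dist_lt a (σ b) (σ y) hab (by rwa [h.dist_eq])
    simpa [h.invol] using h.map_mem _ this
  map_mem := h.map_mem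
  id_map := by rw [h.id_eq]; exact h.id_map
  tree_map := by rw [h.tree_eq]; exact h.tree_map
  root_notMem := by rw [h.root_eq]; exact h.root_notMem

lemma mem_of_nearAcross (h : IsTwin I I' F σ R S ρ) {x z : Fin n}
    (hz : NearAcross F R ρ x z) : z ∈ S := by
  obtain ⟨a, b, hab, hd⟩ := hz
  exact h.mem_of_dist_lt a b z hab (by omega)

lemma mem_of_affected (h : IsTwin I I' F σ R S ρ) {x z : Fin n}
    (hz : Affected F σ R ρ x z) : z ∈ S := by
  rcases hz with hz | hz
  · exact h.mem_of_nearAcross hz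
  · simpa [h.invol] using h.map_mem _ (h.mem_of_nearAcross hz)

/-- The substitution preserves the order of identifiers, among the nodes that are unaffected or
near `x` across an extra edge: no node occurs among them together with its twin. -/
lemma compare_substitute (h : IsTwin I I' F σ R S ρ) {x y z : Fin n}
    (hy : Affected F σ R ρ x y → NearAcross F R ρ x y)
    (hz : Affected F σ R ρ x z → NearAcross F R ρ x z) :
    compare (I.id (substitute F σ R ρ x y)) (I.id (substitute F σ R ρ x z)) =
      compare (I.id y) (I.id z) := by
  have key : ∀ p q : ℕ, ∀ p' q' : ℕ, (p < q ↔ p' < q') → (p = q ↔ p' = q') →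
      compare p q = compare p' q' := by
    intro p q p' q' h1 h2
    rcases lt_trichotomy p q with hlt | heq | hgt
    · rw [compare_lt_iff_lt.2 hlt, compare_lt_iff_lt.2 (h1.1 hlt)]
    · rw [compare_eq_iff_eq.2 heq, compare_eq_iff_eq.2 (h2.1 heq)]
    · rw [compare_gt_iff_gt.2 hgt, compare_gt_iff_gt.2 (by omega)]
  have inj : ∀ {a b : Fin n}, a ≠ b → I.id a ≠ I.id b := fun hab => I.id_injective.ne hab
  by_cases hyz : y = z
  · subst hyz; simp
  have e0 := inj hyz
  have e1 := inj ((h.substitute_injective x).ne hyz)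
  refine key _ _ _ _ ?_ (iff_of_false e1 e0)
  by_cases ay : Affected F σ R ρ x y <;> by_cases az : Affected F σ R ρ x z
  · rw [IsCrossing.substitute_of_affected ay, IsCrossing.substitute_of_affected az] at e1 ⊢
    have e2 : y ≠ σ z := fun e => h.not_nearAcross_map (hz az) (e ▸ hy ay)
    have e3 : σ y ≠ z := fun e => h.not_nearAcross_map (hy ay) (e ▸ hz az)
    have e2 := inj e2
    have e3 := inj e3
    have i1 := h.id_map y (h.mem_of_affected ay)
    have i2 := h.id_map z (h.mem_of_affected az)
    omega
  · rw [IsCrossing.substitute_of_affected ay, IsCrossing.substitute_of_not_affected az] at e1 ⊢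
    have i1 := h.id_map y (h.mem_of_affected ay)
    omega
  · rw [IsCrossing.substitute_of_not_affected ay, IsCrossing.substitute_of_affected az] at e1 ⊢
    have i1 := h.id_map z (h.mem_of_affected az)
    omega
  · rw [IsCrossing.substitute_of_not_affected ay, IsCrossing.substitute_of_not_affected az]

lemma nearAcross_of_mem_known (h : IsTwin I I' F σ R S ρ) {x z : Fin n}
    (hz : z ∈ I.known ρ x) (ha : Affected F σ R ρ x z) : NearAcross F R ρ x z :=
  h.nearAcross_of_affected h.graph_adj ((I.mem_known ρ x).1 hz) ha

lemma dist_substitute (h : IsTwin I I' F σ R S ρ) {x z : Fin n} {r : ℕ} (hr : r ≤ ρ) :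
    I'.graph.dist x (substitute F σ R ρ x z) ≤ r ↔ I.graph.dist x z ≤ r := by
  constructor
  · intro hz
    have := h.flip.dist_substitute_le h.flip.graph_adj h.flip.graph_adj' hr hz
    rwa [h.substitute_swap, h.substitute_substitute] at this
  · exact h.dist_substitute_le h.graph_adj h.graph_adj' hr

lemma known_eq (h : IsTwin I I' F σ R S ρ) (x : Fin n) :
    I'.known ρ x = (I.known ρ x).map (substitute F σ R ρ x) := by
  apply I'.known_eq_of_pairwise
  · exact (I.nodup_known ρ x).map (h.substitute_injective x)
  · rw [List.pairwise_map, h.id_eq]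
    refine (I.pairwise_known ρ x).imp_of_mem fun {a b} ha hb hab => ?_
    have := h.compare_substitute (h.nearAcross_of_mem_known ha) (h.nearAcross_of_mem_known hb)
    rw [← compare_le_iff_le, this, compare_le_iff_le]
    exact hab
  · intro y
    rw [List.mem_map]
    constructor
    · rintro ⟨z, hz, rfl⟩
      exact (h.dist_substitute le_rfl).2 ((I.mem_known ρ x).1 hz)
    · intro hy
      refine ⟨substitute F σ R ρ x y, (I.mem_known ρ x).2 ?_, h.substitute_substitute x y⟩
      rw [← h.dist_substitute le_rfl, h.substitute_substitute]
      exact hy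

lemma substitute_of_dist_le (h : IsTwin I I' F σ R S ρ) {x z : Fin n} (hz : F.dist x z ≤ ρ) :
    substitute F σ R ρ x z = z :=
  IsCrossing.substitute_of_not_affected (h.not_affected_of_dist_le hz)

lemma substitute_of_nearAcross {x z : Fin n}
    (hz : NearAcross F R ρ x z) : substitute F σ R ρ x z = σ z :=
  IsCrossing.substitute_of_affected (Or.inl hz)

/-- An edge of the neighborhood of `x` in `I` becomes an edge with the same label in `I'`, if its
first end point is at distance less than `ρ`. -/
lemma adj_substitute (h : IsTwin I I' F σ R S ρ) {x y z : Fin n} (hyz : I.graph.Adj y z)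
    (hy : I.graph.dist x y + 1 ≤ ρ) :
    I'.graph.Adj (substitute F σ R ρ x y) (substitute F σ R ρ x z) ∧
      (I'.tree (substitute F σ R ρ x y) (substitute F σ R ρ x z) ↔ I.tree y z) ∧
      (I'.tree (substitute F σ R ρ x z) (substitute F σ R ρ x y) ↔ I.tree z y) := by
  have hpos := h.pos
  have notree : ∀ a b, R a b → ¬ I.tree a b := by
    intro a b hab ht
    have h1 := h.far _ _ _ _ hab (h.symm _ _ hab) (h.ne _ _ hab)
    rw [SimpleGraph.dist_eq_one_iff_adj.2 (h.tree_le _ _ ht)] at h1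
    omega
  have notree' : ∀ a b, R a (σ b) → ¬ I.tree a b := by
    intro a b hab ht
    have h1 := h.far _ _ _ _ hab (h.swap.symm _ _ hab) (h.swap.ne _ _ hab)
    rw [SimpleGraph.dist_eq_one_iff_adj.2 (h.tree_le _ _ ht)] at h1
    omega
  rw [h.tree_eq]
  rcases (h.dist_le_iff h.graph_adj x y (r := I.graph.dist x y) (by omega)).1 le_rfl with
    h1 | ⟨a, b, hab, h1⟩
  · rw [h.substitute_of_dist_le (z := y) (by omega)]
    rcases (h.graph_adj _ _).1 hyz with h2 | h2
    · have := h.connected.dist_le_dist_add_one x h2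
      rw [h.substitute_of_dist_le (z := z) (by omega)]
      exact ⟨(h.graph_adj' _ _).2 (Or.inl h2), Iff.rfl, Iff.rfl⟩
    · rw [substitute_of_nearAcross (z := z) ⟨y, z, h2, by simp; omega⟩]
      have h3 : R y (σ (σ z)) := by rwa [h.invol]
      exact ⟨(h.graph_adj' _ _).2 (Or.inr h3),
        iff_of_false (notree' _ _ h3) (notree _ _ h2),
        iff_of_false (notree' _ _ (h.equivariant _ _ (h.symm _ _ h2)))
          (notree _ _ (h.symm _ _ h2))⟩
  · have ny : NearAcross F R ρ x y := ⟨a, b, hab, by omega⟩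
    rw [substitute_of_nearAcross ny]
    rcases (h.graph_adj _ _).1 hyz with h2 | h2
    · have := h.connected.dist_le_dist_add_one b h2
      have nz : NearAcross F R ρ x z := ⟨a, b, hab, by omega⟩
      rw [substitute_of_nearAcross nz]
      have sy := h.mem_of_nearAcross ny
      have sz := h.mem_of_nearAcross nz
      exact ⟨(h.graph_adj' _ _).2 (Or.inl (h.adj _ _ h2)), h.tree_map _ _ sy sz,
        h.tree_map _ _ sz sy⟩
    · have hby : b = y := by
        by_contra hby
        have := h.far _ _ _ _ (h.symm _ _ hab) h2 hby
        omega
      subst hby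
      obtain rfl := h.unique _ _ _ (h.symm _ _ hab) h2
      rw [h.substitute_of_dist_le (z := a) (by omega)]
      have h3 := h.equivariant _ _ h2
      have h4 := h.symm _ _ h3
      exact ⟨(h.graph_adj' _ _).2 (Or.inr h3),
        iff_of_false (notree' _ _ h3) (notree _ _ h2),
        iff_of_false (notree' _ _ (by rw [h.invol]; exact hab)) (notree _ _ hab)⟩

lemma nbhdAdj_substitute (h : IsTwin I I' F σ R S ρ) {x y z : Fin n}
    (hyz : I.nbhdAdj ρ x y z) :
    I'.nbhdAdj ρ x (substitute F σ R ρ x y) (substitute F σ R ρ x z) ∧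
      (I'.tree (substitute F σ R ρ x y) (substitute F σ R ρ x z) ↔ I.tree y z) := by
  obtain ⟨hadj, hy, hz, hne⟩ := hyz
  have hpos := h.pos
  have aux : I'.graph.Adj (substitute F σ R ρ x y) (substitute F σ R ρ x z) ∧
      (I'.tree (substitute F σ R ρ x y) (substitute F σ R ρ x z) ↔ I.tree y z) := by
    by_cases hy' : I.graph.dist x y + 1 ≤ ρ
    · exact ⟨(h.adj_substitute hadj hy').1, (h.adj_substitute hadj hy').2.1⟩
    · have h1 := h.adj_substitute hadj.symm (x := x) (by omega)
      exact ⟨h1.1.symm, h1.2.2⟩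
  have e1 := h.dist_substitute (x := x) (z := y) (r := ρ) le_rfl
  have e2 := h.dist_substitute (x := x) (z := z) (r := ρ) le_rfl
  have e3 := h.dist_substitute (x := x) (z := y) (r := ρ - 1) (by omega)
  have e4 := h.dist_substitute (x := x) (z := z) (r := ρ - 1) (by omega)
  exact ⟨⟨aux.1, e1.2 hy, e2.2 hz, by omega⟩, aux.2⟩

lemma nbhdAdj_substitute_iff (h : IsTwin I I' F σ R S ρ) (x y z : Fin n) :
    I'.nbhdAdj ρ x (substitute F σ R ρ x y) (substitute F σ R ρ x z) ↔ I.nbhdAdj ρ x y z := by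
  refine ⟨fun hyz => ?_, fun hyz => (h.nbhdAdj_substitute hyz).1⟩
  have := (h.flip.nbhdAdj_substitute hyz).1
  simpa only [h.substitute_swap, h.substitute_substitute] using this

lemma root_substitute (h : IsTwin I I' F σ R S ρ) (x y : Fin n) :
    substitute F σ R ρ x y = I.root ↔ y = I.root := by
  have hroot : substitute F σ R ρ x I.root = I.root :=
    IsCrossing.substitute_of_not_affected fun ha => h.root_notMem (h.mem_of_affected ha)
  constructor
  · intro hy
    rw [← h.substitute_substitute x y, hy, hroot]
  · rintro rfl
    exact hroot

/-- No node can tell the two inputs apart at the start. -/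
lemma view_eq (h : IsTwin I I' F σ R S ρ) (x : Fin n) : I'.view ρ x = I.view ρ x := by
  have hx : substitute F σ R ρ x x = x := h.substitute_of_dist_le (by simp)
  have hget : ∀ (i : ℕ) (y : Fin n), (I'.known ρ x)[i]? = some y ↔
      (I.known ρ x)[i]? = some (substitute F σ R ρ x y) := by
    intro i y
    rw [h.known_eq, List.getElem?_map, Option.map_eq_some_iff]
    constructor
    · rintro ⟨z, hz, rfl⟩
      rw [hz, h.substitute_substitute]
    · intro hz
      exact ⟨_, hz, h.substitute_substitute x y⟩
  unfold BFSInput.view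
  congr 1
  · rw [h.known_eq, List.length_map]
  · have := List.idxOf_map_of_injective (h.substitute_injective x) (I.known ρ x) x
    rwa [hx, ← h.known_eq] at this
  · ext i j
    constructor
    · rintro ⟨y, z, hy, hz, hyz⟩
      refine ⟨_, _, (hget i y).1 hy, (hget j z).1 hz, ?_⟩
      rw [← h.nbhdAdj_substitute_iff, h.substitute_substitute, h.substitute_substitute]
      exact hyz
    · rintro ⟨y, z, hy, hz, hyz⟩
      refine ⟨substitute F σ R ρ x y, substitute F σ R ρ x z, ?_, ?_,
        (h.nbhdAdj_substitute_iff _ _ _).2 hyz⟩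
      · rw [hget, h.substitute_substitute, hy]
      · rw [hget, h.substitute_substitute, hz]
  · ext i j
    constructor
    · rintro ⟨y, z, hy, hz, hyz, ht⟩
      have hyz' : I.nbhdAdj ρ x (substitute F σ R ρ x y) (substitute F σ R ρ x z) := by
        rw [← h.nbhdAdj_substitute_iff, h.substitute_substitute, h.substitute_substitute]
        exact hyz
      refine ⟨_, _, (hget i y).1 hy, (hget j z).1 hz, hyz', ?_⟩
      rw [← (h.nbhdAdj_substitute hyz').2, h.substitute_substitute, h.substitute_substitute]
      exact ht
    · rintro ⟨y, z, hy, hz, hyz, ht⟩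
      refine ⟨substitute F σ R ρ x y, substitute F σ R ρ x z, ?_, ?_,
        (h.nbhdAdj_substitute_iff _ _ _).2 hyz, (h.nbhdAdj_substitute hyz).2.2 ht⟩
      · rw [hget, h.substitute_substitute, hy]
      · rw [hget, h.substitute_substitute, hz]
  · ext i
    rw [hget, h.root_eq, (h.root_substitute x I.root).2 rfl]

end IsTwin

/-! ### Executions on crossed inputs -/

lemma List.exists_map_eq {α β : Type*} {f : α → β} {P : α → Prop} {l : List β}
    (h : ∀ b ∈ l, ∃ a, P a ∧ f a = b) : ∃ l' : List α, l'.map f = l ∧ ∀ a ∈ l', P a := by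
  induction l with
  | nil => exact ⟨[], by simp⟩
  | cons b l ih =>
    obtain ⟨l', h1, h2⟩ := ih fun b hb => h b (List.mem_cons_of_mem _ hb)
    obtain ⟨a, ha, rfl⟩ := h b List.mem_cons_self
    exact ⟨a :: l', by simp [h1], by simpa using ⟨ha, h2⟩⟩

namespace ComparisonAlgorithm

variable {B n : ℕ}

/-- The message from `y` to `x` may reveal the crossing of the extra edges `R`: it travels along an
extra edge, or it carries the identifier of a node that is affected for its sender or receiver. -/
def Charged (A : ComparisonAlgorithm B) (I : BFSInput n) (ρ : ℕ) (F : SimpleGraph (Fin n))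
    (σ : Fin n → Fin n) (R : Fin n → Fin n → Prop) (c : Fin n → A.NodeState) (y x : Fin n) :
    Prop :=
  ∃ m, A.message I ρ c y x = some m ∧
    (R y x ∨ ∃ z, I.id z ∈ m.2 ∧ (Affected F σ R ρ y z ∨ Affected F σ R ρ x z))

/-- The states of `x` in the executions on two crossed inputs correspond to each other: they agree
up to the substitution in the ID variables. -/
def StatesMatch (A : ComparisonAlgorithm B) (I : BFSInput n) (ρ : ℕ) (F : SimpleGraph (Fin n))
    (σ : Fin n → Fin n) (R : Fin n → Fin n → Prop) (c c' : Fin n → A.NodeState) (x : Fin n) :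
    Prop :=
  (c' x).ordinary = (c x).ordinary ∧ ∃ l : List (Fin n), (c x).ids = l.map I.id ∧
    (c' x).ids = l.map (fun z => I.id (substitute F σ R ρ x z)) ∧
    ∀ z ∈ l, Affected F σ R ρ x z → NearAcross F R ρ x z

variable {A : ComparisonAlgorithm B} {I I' : BFSInput n} {F : SimpleGraph (Fin n)}
  {σ : Fin n → Fin n} {R : Fin n → Fin n → Prop} {S : Set (Fin n)} {ρ : ℕ}
  {c c' : Fin n → A.NodeState}

lemma comparisons_map_congr {α : Type*} {f g : α → ℕ} {l : List α}
    (h : ∀ a ∈ l, ∀ b ∈ l, compare (f a) (f b) = compare (g a) (g b)) :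
    comparisons (l.map f) = comparisons (l.map g) := by
  simp only [comparisons, List.map_map]
  refine List.map_congr_left fun a ha => ?_
  simp only [Function.comp]
  exact List.map_congr_left fun b hb => h a ha b hb

lemma StatesMatch.comparisons_eq (h : IsTwin I I' F σ R S ρ) {x : Fin n}
    (hm : A.StatesMatch I ρ F σ R c c' x) :
    comparisons (c' x).ids = comparisons (c x).ids := by
  obtain ⟨-, l, h1, h2, h3⟩ := hm
  rw [h1, h2]
  exact comparisons_map_congr fun a ha b hb => h.compare_substitute (h3 a ha) (h3 b hb)

/-- Every identifier in a message is the identifier of a node. -/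
lemma exists_of_mem_message {y x : Fin n} (hm : A.StatesMatch I ρ F σ R c c' y)
    {m : A.Content × List ℕ} (hmsg : A.message I ρ c y x = some m) {k : ℕ} (hk : k ∈ m.2) :
    ∃ z, I.id z = k := by
  obtain ⟨-, l, h1, -, -⟩ := hm
  unfold message at hmsg
  split_ifs at hmsg
  obtain ⟨m₀, -, rfl⟩ := Option.map_eq_some_iff.1 hmsg
  obtain ⟨i, -, hi⟩ := List.mem_filterMap.1 hk
  rw [h1] at hi
  obtain ⟨z, -, hz⟩ := List.mem_map.1 (List.mem_of_getElem? hi)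
  exact ⟨z, hz⟩

/-- The slot of `x` at `y` after the crossing is the slot at `y` of the node that `x` replaces. -/
lemma idxOf_known_eq (h : IsTwin I I' F σ R S ρ) (y x : Fin n) :
    (I'.known ρ y).idxOf (substitute F σ R ρ y x) = (I.known ρ y).idxOf x := by
  rw [h.known_eq]
  exact List.idxOf_map_of_injective (h.substitute_injective y) _ _

/-- A node receives the same message in corresponding states, from the corresponding sender. -/
lemma message_eq (h : IsTwin I I' F σ R S ρ) (hm : ∀ x, A.StatesMatch I ρ F σ R c c' x)
    (hun : ∀ y x, ¬ A.Charged I ρ F σ R c y x) (y x : Fin n) :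
    A.message I' ρ c' (substitute F σ R ρ x y) x = A.message I ρ c y x := by
  have hpos := h.pos
  by_cases hadj : I.graph.Adj y x
  · rcases (h.graph_adj _ _).1 hadj with hF | hR
    · have hxy : F.dist x y ≤ ρ := by rw [SimpleGraph.dist_eq_one_iff_adj.2 hF.symm]; exact hpos
      have hyx : F.dist y x ≤ ρ := by rwa [F.dist_comm]
      have hslot := idxOf_known_eq h y x
      rw [h.substitute_of_dist_le hyx] at hslot
      rw [h.substitute_of_dist_le hxy]
      have hnc := hun y x
      obtain ⟨l, h1, h2, -⟩ := (hm y).2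
      unfold Charged at hnc
      unfold message at hnc ⊢
      rw [if_pos hadj] at hnc ⊢
      rw [if_pos ((h.graph_adj' y x).2 (Or.inl hF)), hslot, (hm y).1, (hm y).comparisons_eq h]
      cases hs : A.send (c y).ordinary (comparisons (c y).ids) ((I.known ρ y).idxOf x) with
      | none => rfl
      | some m₀ =>
        rw [hs] at hnc
        simp only [Option.map_some, Option.some.injEq, Prod.mk.injEq, true_and]
        refine List.filterMap_congr fun i hi => ?_
        rw [h1, h2, List.getElem?_map, List.getElem?_map]
        cases hz : l[i]? with
        | none => rfl
        | some z =>
          -- an affected identifier in the message would have been charged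
          have hnz : ¬ Affected F σ R ρ y z := fun hz' =>
            hnc ⟨_, rfl, Or.inr ⟨z, List.mem_filterMap.2
              ⟨i, hi, by rw [h1, List.getElem?_map, hz]; rfl⟩, Or.inl hz'⟩⟩
          simp [IsCrossing.substitute_of_not_affected hnz]
    · have hnear : NearAcross F R ρ x y := ⟨x, y, h.symm _ _ hR, by simp; omega⟩
      have hR' := h.equivariant _ _ hR
      -- no message is sent across the extra edges `y x` and `(σ y) (σ x)`
      have none1 : ∀ a b, R a b → A.message I ρ c a b = none := by
        intro a b hab
        by_contra hne
        obtain ⟨m, hm'⟩ := Option.ne_none_iff_exists'.1 hne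
        exact hun a b ⟨m, hm', Or.inl hab⟩
      rw [none1 y x hR, IsTwin.substitute_of_nearAcross hnear]
      have hn := none1 _ _ hR'
      have hslot := idxOf_known_eq h (σ y) (σ x)
      rw [IsTwin.substitute_of_nearAcross ⟨σ y, σ x, hR', by simp; omega⟩, h.invol] at hslot
      unfold message at hn ⊢
      rw [if_pos ((h.graph_adj _ _).2 (Or.inr hR')), Option.map_eq_none_iff] at hn
      rw [if_pos ((h.graph_adj' _ _).2 (Or.inr hR')), hslot, (hm _).1, (hm _).comparisons_eq h, hn]
      rfl
  · have hadj' : ¬ I'.graph.Adj (substitute F σ R ρ x y) x := by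
      intro hadj'
      have := (h.flip.adj_substitute (x := x) hadj'.symm (by simpa using hpos)).1
      rw [h.substitute_swap, h.substitute_swap, h.substitute_substitute,
        h.substitute_of_dist_le (by simp)] at this
      exact hadj this.symm
    unfold message
    rw [if_neg hadj, if_neg hadj']

lemma inbox_eq (h : IsTwin I I' F σ R S ρ) (hm : ∀ x, A.StatesMatch I ρ F σ R c c' x)
    (hun : ∀ y x, ¬ A.Charged I ρ F σ R c y x) (x : Fin n) :
    A.inbox I' ρ c' x = A.inbox I ρ c x := by
  unfold inbox
  have hslot := idxOf_known_eq h x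
  conv_lhs => rw [h.known_eq, List.filterMap_map]
  refine List.filterMap_congr fun y _ => ?_
  simp only [Function.comp]
  rw [message_eq h hm hun, ← h.known_eq, hslot]

/-- As long as no message is charged, the executions on crossed inputs correspond. -/
lemma statesMatch_run (h : IsTwin I I' F σ R S ρ) {ω : Fin n × ℕ → Bool}
    (hun : ∀ r y x, ¬ A.Charged I ρ F σ R (A.run I ρ ω r) y x) (r : ℕ) (x : Fin n) :
    A.StatesMatch I ρ F σ R (A.run I ρ ω r) (A.run I' ρ ω r) x := by
  induction r generalizing x with
  | zero =>
    refine ⟨by simp only [run]; rw [h.view_eq], I.known ρ x, rfl, ?_,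
      fun z hz ha => h.nearAcross_of_mem_known hz ha⟩
    simp only [run]
    rw [h.known_eq, List.map_map, h.id_eq]
    rfl
  | succ r ih =>
    have hin := inbox_eq h ih (hun r) x
    obtain ⟨hord, l, h1, h2, h3⟩ := ih x
    obtain ⟨l', h4, h5⟩ : ∃ l' : List (Fin n),
        l'.map I.id = ((A.inbox I ρ (A.run I ρ ω r) x).flatMap fun m => m.2.2) ∧
          ∀ z ∈ l', ¬ Affected F σ R ρ x z := by
      refine List.exists_map_eq fun k hk => ?_
      obtain ⟨m, hmem, hk⟩ := List.mem_flatMap.1 hk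
      obtain ⟨y, -, hy⟩ := List.mem_filterMap.1 hmem
      obtain ⟨m', hm', rfl⟩ := Option.map_eq_some_iff.1 hy
      obtain ⟨z, rfl⟩ := exists_of_mem_message (ih y) hm' hk
      exact ⟨z, fun hz => hun r y x ⟨m', hm', Or.inr ⟨z, hk, Or.inr hz⟩⟩, rfl⟩
    have hids : A.StatesMatch I ρ F σ R
        (fun x => ⟨(A.run I ρ ω r x).ids ++
          ((A.inbox I ρ (A.run I ρ ω r) x).flatMap fun m => m.2.2), (A.run I ρ ω r x).ordinary⟩)
        (fun x => ⟨(A.run I' ρ ω r x).ids ++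
          ((A.inbox I' ρ (A.run I' ρ ω r) x).flatMap fun m => m.2.2),
          (A.run I' ρ ω r x).ordinary⟩) x := by
      refine ⟨hord, l ++ l', ?_, ?_, ?_⟩
      · simp only [List.map_append, h1, h4]
      · simp only
        rw [hin, h2, ← h4, List.map_append]
        congr 1
        refine List.map_congr_left fun z hz => ?_
        rw [IsCrossing.substitute_of_not_affected (h5 z hz)]
      · intro z hz ha
        rcases List.mem_append.1 hz with hz | hz
        · exact h3 z hz ha
        · exact absurd ha (h5 z hz)
    have hcomp := hids.comparisons_eq h
    refine ⟨?_, hids.2⟩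
    simp only [run]
    simp only at hcomp
    rw [hcomp, hin, hord]

/-- If no message is charged, then all nodes give the same outputs on crossed inputs. -/
lemma outputs_iff (h : IsTwin I I' F σ R S ρ) {ω : Fin n × ℕ → Bool}
    (hun : ∀ r y x, ¬ A.Charged I ρ F σ R (A.run I ρ ω r) y x) (x : Fin n) (b : Bool) :
    A.Outputs I' ρ ω x b ↔ A.Outputs I ρ ω x b := by
  simp only [Outputs, fun r => (statesMatch_run h hun r x).1]

lemma outputs_unique {ω : Fin n × ℕ → Bool} {x : Fin n} {b b' : Bool}
    (h : A.Outputs I ρ ω x b) (h' : A.Outputs I ρ ω x b') : b = b' := by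
  obtain ⟨r, h1, h2⟩ := h
  obtain ⟨r', h1', h2'⟩ := h'
  rcases lt_trichotomy r r' with hlt | rfl | hlt
  · simp [h2' r hlt] at h1
  · simpa [h1] using h1'
  · simp [h2 r' hlt] at h1'

/-- If the crossing turns an approximate BFS tree into something else, then an execution that is
correct on both inputs contains a charged message. -/
lemma exists_charged (h : IsTwin I I' F σ R S ρ) {d : ℝ} (hI : I.IsApproxBFSTree d)
    (hI' : ¬ I'.IsApproxBFSTree d) {ω : Fin n × ℕ → Bool} (hc : A.Correct I ρ d ω)
    (hc' : A.Correct I' ρ d ω) : ∃ r y x, A.Charged I ρ F σ R (A.run I ρ ω r) y x := by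
  by_contra! hun
  obtain ⟨x, hx⟩ := hc'.2.2 hI'
  rw [outputs_iff h hun] at hx
  exact absurd (outputs_unique hx (hc.2.1 hI x)) (by simp)

end ComparisonAlgorithm

/-! ### Measurability of executions -/

namespace ComparisonAlgorithm

variable {B n : ℕ}

instance (A : ComparisonAlgorithm B) : Countable A.NodeState := by
  have := A.countable_state
  refine Function.Injective.countable (f := fun s : A.NodeState => (s.ids, s.ordinary)) ?_
  rintro ⟨a, b⟩ ⟨a', b'⟩ h
  simpa using h

instance : IsProbabilityMeasure (coins n) := by
  unfold coins
  infer_instance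

/-- The nodes take only countably many states, so that every property of the states after a given
number of rounds is an event. -/
lemma measurable_run (A : ComparisonAlgorithm B) (I : BFSInput n) (ρ r : ℕ)
    (P : (Fin n → A.NodeState) → Prop) : Measurable fun ω => P (A.run I ρ ω r) := by
  have tape : ∀ x : Fin n, Measurable fun (ω : Fin n × ℕ → Bool) (i : ℕ) => ω (x, i) :=
    fun x => by fun_prop
  suffices H : ∀ c, MeasurableSet {ω | A.run I ρ ω r = c} by
    rw [← measurableSet_setOfPred]
    have : {ω | P (A.run I ρ ω r)} = ⋃ c ∈ {c | P c}, {ω | A.run I ρ ω r = c} := by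
      ext ω; simp
    rw [this]
    exact MeasurableSet.biUnion (Set.to_countable _) fun c _ => H c
  induction r with
  | zero =>
    intro c
    have : {ω | A.run I ρ ω 0 = c} = ⋂ x, {ω | A.run I ρ ω 0 x = c x} := by
      ext ω; simp [funext_iff]
    rw [this]
    refine MeasurableSet.iInter fun x => ?_
    exact @Measurable.comp _ _ _ _ _ ⊤ _ _ (A.measurable_init (I.view ρ x)) (tape x)
      {s | (⟨(I.known ρ x).map I.id, s⟩ : A.NodeState) = c x} trivial
  | succ r ih =>
    intro c
    have : {ω | A.run I ρ ω (r + 1) = c} = ⋃ c₀, {ω | A.run I ρ ω r = c₀} ∩ ⋂ x,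
        {ω | (⟨(c₀ x).ids ++ (A.inbox I ρ c₀ x).flatMap fun m => m.2.2,
          A.next (c₀ x).ordinary
            (comparisons ((c₀ x).ids ++ (A.inbox I ρ c₀ x).flatMap fun m => m.2.2))
            ((A.inbox I ρ c₀ x).map fun m => (m.1, m.2.1, m.2.2.length))
            fun i => ω (x, i)⟩ : A.NodeState) = c x} := by
      ext ω
      simp only [Set.mem_iUnion, Set.mem_inter_iff, Set.mem_iInter, Set.mem_ofPred_eq]
      constructor
      · rintro rfl
        exact ⟨_, rfl, fun x => rfl⟩
      · rintro ⟨_, rfl, h⟩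
        exact funext h
    rw [this]
    refine MeasurableSet.iUnion fun c₀ => (ih c₀).inter (MeasurableSet.iInter fun x => ?_)
    exact @Measurable.comp _ _ _ _ _ ⊤ _ _ (A.measurable_next _ _ _) (tape x)
      {s | (⟨_, s⟩ : A.NodeState) = c x} trivial

lemma measurable_outputs (A : ComparisonAlgorithm B) (I : BFSInput n) (ρ : ℕ) (x : Fin n)
    (b : Bool) : Measurable fun ω => A.Outputs I ρ ω x b := by
  unfold Outputs
  refine Measurable.exists fun r => Measurable.and
    (A.measurable_run I ρ r fun c => A.output (c x).ordinary = some b)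
    (Measurable.forall fun s => Measurable.imp measurable_const
      (A.measurable_run I ρ s fun c => A.output (c x).ordinary = none))

lemma measurableSet_correct (A : ComparisonAlgorithm B) (I : BFSInput n) (ρ : ℕ) (d : ℝ) :
    MeasurableSet {ω | A.Correct I ρ d ω} := by
  rw [measurableSet_setOfPred]
  unfold Correct
  refine Measurable.and (Measurable.forall fun x => Measurable.exists fun b =>
    A.measurable_outputs I ρ x b) (Measurable.and ?_ ?_)
  · exact Measurable.imp measurable_const (Measurable.forall fun x => A.measurable_outputs I ρ x _)
  · exact Measurable.imp measurable_const (Measurable.exists fun x => A.measurable_outputs I ρ x _)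

end ComparisonAlgorithm

/-! ### Counting charges -/

open Classical in
/-- For given nodes `x` and `z`, few of the extra edges lie on a short path from `x` to `z`: all of
them lie on one fixed shortest path. -/
lemma card_nearAcross_le {V ι : Type*} {E : Finset ι} {G : SimpleGraph V}
    {F : ι → SimpleGraph V} {σ : V → V} {R : ι → V → V → Prop} {ρ : ℕ}
    (h : ∀ e ∈ E, IsCrossing (F e) σ (R e) ρ)
    (hG : ∀ e ∈ E, ∀ x y, G.Adj x y ↔ (F e).Adj x y ∨ R e x y)
    (hR : ∀ e ∈ E, ∀ e' ∈ E, ∀ a b, R e a b → R e' a b → e = e') (x z : V) :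
    (E.filter fun e => NearAcross (F e) (R e) ρ x z).card ≤ ρ := by
  rcases (E.filter fun e => NearAcross (F e) (R e) ρ x z).eq_empty_or_nonempty with h0 | ⟨e₀, he₀⟩
  · rw [h0]; simp
  rw [Finset.mem_filter] at he₀
  have hdist : G.dist x z ≤ ρ :=
    ((h e₀ he₀.1).dist_le_iff (hG e₀ he₀.1) x z le_rfl).2 (Or.inr he₀.2)
  have hconn : G.Connected :=
    (h e₀ he₀.1).connected.mono fun _ _ hab => (hG e₀ he₀.1 _ _).2 (Or.inl hab)
  obtain ⟨p, hp⟩ := hconn.exists_walk_length_eq_dist x z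
  have key : ∀ e ∈ E.filter fun e => NearAcross (F e) (R e) ρ x z,
      ∃ s ∈ p.edges, ∃ a b, s = s(a, b) ∧ R e a b := by
    intro e he
    rw [Finset.mem_filter] at he
    by_contra! hno
    refine (h e he.1).not_dist_le_of_nearAcross he.2 ?_
    have hp' : ∀ s ∈ p.edges, s ∈ (F e).edgeSet := by
      intro s hs
      have hs' := p.edges_subset_edgeSet hs
      induction s with
      | h a b =>
        rw [SimpleGraph.mem_edgeSet] at hs' ⊢
        exact ((hG e he.1 a b).1 hs').resolve_right (hno _ hs a b rfl)
    have := (F e).dist_le (p.transfer (F e) hp')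
    rw [SimpleGraph.Walk.length_transfer] at this
    omega
  have : Nonempty V := ⟨x⟩
  have : Nonempty (Sym2 V) := ⟨s(x, x)⟩
  choose! f hf a b hfab hRab using key
  calc (E.filter fun e => NearAcross (F e) (R e) ρ x z).card ≤ p.edges.toFinset.card := by
        refine Finset.card_le_card_of_injOn f (fun e he => ?_) ?_
        · simpa using hf e he
        · intro e he e' he' hee
          have hE := (Finset.mem_filter.1 he).1
          have hE' := (Finset.mem_filter.1 he').1
          rw [hfab e he, hfab e' he', Sym2.eq_iff] at hee
          rcases hee with ⟨h1, h2⟩ | ⟨h1, h2⟩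
          · exact hR e hE e' hE' _ _ (hRab e he) (h1 ▸ h2 ▸ hRab e' he')
          · exact hR e hE e' hE' _ _ (hRab e he)
              (h1 ▸ h2 ▸ (h e' hE').symm _ _ (hRab e' he'))
    _ ≤ p.edges.length := List.toFinset_card_le _
    _ ≤ ρ := by rw [SimpleGraph.Walk.length_edges, hp]; exact hdist

open Classical in
lemma card_affected_le {V ι : Type*} {E : Finset ι} {G : SimpleGraph V}
    {F : ι → SimpleGraph V} {σ : V → V} {R : ι → V → V → Prop} {ρ : ℕ}
    (h : ∀ e ∈ E, IsCrossing (F e) σ (R e) ρ)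
    (hG : ∀ e ∈ E, ∀ x y, G.Adj x y ↔ (F e).Adj x y ∨ R e x y)
    (hR : ∀ e ∈ E, ∀ e' ∈ E, ∀ a b, R e a b → R e' a b → e = e') (x z : V) :
    (E.filter fun e => Affected (F e) σ (R e) ρ x z).card ≤ 2 * ρ := by
  have h1 := card_nearAcross_le h hG hR x z
  have h2 := card_nearAcross_le h hG hR x (σ z)
  have hsub : (E.filter fun e => Affected (F e) σ (R e) ρ x z) ⊆
      (E.filter fun e => NearAcross (F e) (R e) ρ x z) ∪
        (E.filter fun e => NearAcross (F e) (R e) ρ x (σ z)) := by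
    intro e he
    obtain ⟨he, ha⟩ := Finset.mem_filter.1 he
    rw [Finset.mem_union, Finset.mem_filter, Finset.mem_filter]
    exact ha.imp (fun h => ⟨he, h⟩) (fun h => ⟨he, h⟩)
  refine (Finset.card_le_card hsub).trans ((Finset.card_union_le _ _).trans ?_)
  omega

namespace ComparisonAlgorithm

variable {B n : ℕ}

/-- The number of identifiers in a message is at most `B`. -/
lemma length_message_le {A : ComparisonAlgorithm B} {I : BFSInput n} {ρ : ℕ}
    {c : Fin n → A.NodeState} {y x : Fin n} {m : A.Content × List ℕ}
    (hm : A.message I ρ c y x = some m) : m.2.length ≤ B := by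
  unfold message at hm
  split_ifs at hm
  obtain ⟨m₀, hs, rfl⟩ := Option.map_eq_some_iff.1 hm
  exact (List.length_filterMap_le _ _).trans (A.send_length _ _ _ _ hs)

open Classical in
/-- A single message charges at most `1 + 4 * B * ρ` of the pairs of extra edges. -/
lemma card_charged_le {ι : Type*} {A : ComparisonAlgorithm B} {I : BFSInput n} {ρ : ℕ}
    {E : Finset ι} {F : ι → SimpleGraph (Fin n)} {σ : Fin n → Fin n}
    {R : ι → Fin n → Fin n → Prop} (h : ∀ e ∈ E, IsCrossing (F e) σ (R e) ρ)
    (hG : ∀ e ∈ E, ∀ x y, I.graph.Adj x y ↔ (F e).Adj x y ∨ R e x y)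
    (hR : ∀ e ∈ E, ∀ e' ∈ E, ∀ a b, R e a b → R e' a b → e = e')
    (c : Fin n → A.NodeState) (y x : Fin n) :
    (E.filter fun e => A.Charged I ρ (F e) σ (R e) c y x).card ≤
      if (A.message I ρ c y x).isSome then 1 + 4 * B * ρ else 0 := by
  cases hm : A.message I ρ c y x with
  | none =>
    have : (E.filter fun e => A.Charged I ρ (F e) σ (R e) c y x) = ∅ := by
      refine Finset.filter_eq_empty_iff.2 fun e _ ⟨m, hm', _⟩ => ?_
      rw [hm] at hm'
      simp at hm'
    simp [this]
  | some m =>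
    set Z : Finset (Fin n) := Finset.univ.filter fun z => I.id z ∈ m.2 with hZ
    have hZcard : Z.card ≤ B := by
      refine le_trans ?_ (length_message_le hm)
      refine le_trans ?_ (List.toFinset_card_le m.2)
      exact Finset.card_le_card_of_injOn I.id (fun z hz => by simpa [hZ] using hz)
        I.id_injective.injOn
    have hsub : (E.filter fun e => A.Charged I ρ (F e) σ (R e) c y x) ⊆
        (E.filter fun e => R e y x) ∪ Z.biUnion fun z =>
          (E.filter fun e => Affected (F e) σ (R e) ρ y z) ∪
            (E.filter fun e => Affected (F e) σ (R e) ρ x z) := by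
      intro e he
      obtain ⟨heE, m', hm', hch⟩ := Finset.mem_filter.1 he
      rw [hm, Option.some.injEq] at hm'
      subst hm'
      simp only [Finset.mem_union, Finset.mem_filter, Finset.mem_biUnion, hZ, Finset.mem_univ,
        true_and]
      rcases hch with h1 | ⟨z, hz, h1⟩
      · exact Or.inl ⟨heE, h1⟩
      · exact Or.inr ⟨z, hz, h1.imp (fun h => ⟨heE, h⟩) (fun h => ⟨heE, h⟩)⟩
    have h1 : (E.filter fun e => R e y x).card ≤ 1 := by
      refine Finset.card_le_one.2 fun e he e' he' => ?_
      rw [Finset.mem_filter] at he he'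
      exact hR e he.1 e' he'.1 _ _ he.2 he'.2
    have h2 : (Z.biUnion fun z => (E.filter fun e => Affected (F e) σ (R e) ρ y z) ∪
            (E.filter fun e => Affected (F e) σ (R e) ρ x z)).card ≤ Z.card * (4 * ρ) := by
      refine Finset.card_biUnion_le_card_mul _ _ _ fun z _ => ?_
      have h3 := card_affected_le h hG hR y z
      have h4 := card_affected_le h hG hR x z
      exact (Finset.card_union_le _ _).trans (by omega)
    have h5 : Z.card * (4 * ρ) ≤ 4 * B * ρ := by
      calc Z.card * (4 * ρ) ≤ B * (4 * ρ) := Nat.mul_le_mul_right _ hZcard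
        _ = 4 * B * ρ := by ring
    have := Finset.card_le_card hsub
    have := Finset.card_union_le (E.filter fun e => R e y x) (Z.biUnion fun z =>
      (E.filter fun e => Affected (F e) σ (R e) ρ y z) ∪
        (E.filter fun e => Affected (F e) σ (R e) ρ x z))
    simp only [Option.isSome_some, if_true]
    omega

open Classical in
/-- If many crossings turn a positive input `I` into a negative one, then many messages are sent on
input `I`: with probability at least one half each crossing is charged, and a single message
charges few crossings. -/
lemma card_le_expectedMessages {ι : Type*} {A : ComparisonAlgorithm B} {k ρ : ℕ}
    {I : BFSInput n} {d ε : ℝ} (hε : ε ≤ 1 / 4) (hA : A.Solves n k ρ d ε)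
    {E : Finset ι} {I' : ι → BFSInput n} {F : ι → SimpleGraph (Fin n)} {σ : Fin n → Fin n}
    {R : ι → Fin n → Fin n → Prop} {S : Set (Fin n)}
    (h : ∀ e ∈ E, IsTwin I (I' e) (F e) σ (R e) S ρ)
    (hR : ∀ e ∈ E, ∀ e' ∈ E, ∀ a b, R e a b → R e' a b → e = e')
    (hid : ∀ x, I.id x < n ^ k) (hI : I.IsApproxBFSTree d)
    (hI' : ∀ e ∈ E, ¬ (I' e).IsApproxBFSTree d) :
    (E.card : ℝ≥0∞) * 2⁻¹ ≤ ((1 + 4 * B * ρ : ℕ) : ℝ≥0∞) * A.expectedMessages I ρ := by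
  set U : ι → Set (Fin n × ℕ → Bool) := fun e =>
    {ω | ∃ r y x, A.Charged I ρ (F e) σ (R e) (A.run I ρ ω r) y x} with hU
  have hUmeas : ∀ e, MeasurableSet (U e) := by
    intro e
    rw [hU, measurableSet_setOfPred]
    exact Measurable.exists fun r => Measurable.exists fun y => Measurable.exists fun x =>
      A.measurable_run I ρ r fun c => A.Charged I ρ (F e) σ (R e) c y x
  have hUprob : ∀ e ∈ E, (2 : ℝ≥0∞)⁻¹ ≤ coins n (U e) := by
    intro e he
    have h1 := hA I hid
    have h2 := hA (I' e) (by rw [(h e he).id_eq]; exact hid)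
    have h3 := measure_union_add_inter {ω | A.Correct I ρ d ω} (μ := coins n)
      (A.measurableSet_correct (I' e) ρ d)
    have h4 : coins n ({ω | A.Correct I ρ d ω} ∩ {ω | A.Correct (I' e) ρ d ω}) ≤ coins n (U e) :=
      measure_mono fun ω hω => exists_charged (h e he) hI (hI' e he) hω.1 hω.2
    have h5 : coins n ({ω | A.Correct I ρ d ω} ∪ {ω | A.Correct (I' e) ρ d ω}) ≤ 1 := prob_le_one
    have h6 : ENNReal.ofReal (3 / 4) ≤ ENNReal.ofReal (1 - ε) :=
      ENNReal.ofReal_le_ofReal (by linarith)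
    have h7 : (1 : ℝ≥0∞) + 2⁻¹ = ENNReal.ofReal (3 / 4) + ENNReal.ofReal (3 / 4) := by
      rw [← ENNReal.ofReal_add (by norm_num) (by norm_num), ← ENNReal.ofReal_one,
        show (2 : ℝ≥0∞) = ENNReal.ofReal 2 by simp, ← ENNReal.ofReal_inv_of_pos (by norm_num),
        ← ENNReal.ofReal_add (by norm_num) (by norm_num)]
      norm_num
    have h8 : (1 : ℝ≥0∞) + 2⁻¹ ≤ 1 + coins n (U e) := by
      rw [h7]
      refine (add_le_add (h6.trans h1) (h6.trans h2)).trans ?_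
      rw [← h3]
      exact add_le_add h5 h4
    exact (ENNReal.add_le_add_iff_left ENNReal.one_ne_top).1 h8
  have hpoint : ∀ ω, ∑ e ∈ E, (U e).indicator 1 ω ≤
      ((1 + 4 * B * ρ : ℕ) : ℝ≥0∞) * A.messageCount I ρ ω := by
    intro ω
    have h1 : ∀ e ∈ E, (U e).indicator 1 ω ≤ ∑' r : ℕ, ∑ p : Fin n × Fin n,
        if A.Charged I ρ (F e) σ (R e) (A.run I ρ ω r) p.1 p.2 then (1 : ℝ≥0∞) else 0 := by
      intro e _
      by_cases hω : ω ∈ U e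
      · rw [Set.indicator_of_mem hω]
        obtain ⟨r, y, x, hch⟩ := hω
        refine le_trans ?_ (ENNReal.le_tsum r)
        refine le_trans ?_ (Finset.single_le_sum (fun _ _ => zero_le) (Finset.mem_univ (y, x)))
        simp [hch]
      · rw [Set.indicator_of_notMem hω]
        exact zero_le
    refine (Finset.sum_le_sum h1).trans ?_
    rw [← Summable.tsum_finsetSum fun _ _ => ENNReal.summable, messageCount,
      ← ENNReal.tsum_mul_left]
    refine ENNReal.tsum_le_tsum fun r => ?_
    rw [Finset.sum_comm, Finset.card_filter, Nat.cast_sum, Finset.mul_sum]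
    refine Finset.sum_le_sum fun p _ => ?_
    rw [Finset.sum_boole, ← Nat.cast_mul, Nat.cast_le]
    refine (card_charged_le (fun e he => (h e he).toIsCrossing) (fun e he => (h e he).graph_adj) hR
      _ _ _).trans (le_of_eq ?_)
    split_ifs <;> simp
  calc (E.card : ℝ≥0∞) * 2⁻¹ = ∑ e ∈ E, (2 : ℝ≥0∞)⁻¹ := by
        rw [Finset.sum_const, nsmul_eq_mul]
    _ ≤ ∑ e ∈ E, coins n (U e) := Finset.sum_le_sum hUprob
    _ = ∑ e ∈ E, ∫⁻ ω, (U e).indicator 1 ω ∂ coins n := by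
        simp only [lintegral_indicator_one (hUmeas _)]
    _ = ∫⁻ ω, ∑ e ∈ E, (U e).indicator 1 ω ∂ coins n :=
        (lintegral_finsetSum _ fun e _ => measurable_one.indicator (hUmeas e)).symm
    _ ≤ ∫⁻ ω, ((1 + 4 * B * ρ : ℕ) : ℝ≥0∞) * A.messageCount I ρ ω ∂ coins n :=
        lintegral_mono hpoint
    _ = ((1 + 4 * B * ρ : ℕ) : ℝ≥0∞) * A.expectedMessages I ρ :=
        lintegral_const_mul' _ _ (ENNReal.natCast_ne_top _)

end ComparisonAlgorithm

/-! ### Dense graphs without short cycles -/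

namespace SimpleGraph

variable {V : Type*}

/-- Every cycle of `H` has length more than `2 * ρ`: the end points of an edge have distance at
least `2 * ρ` once the edge is deleted. -/
def NoShortCycle (H : SimpleGraph V) (ρ : ℕ) : Prop :=
  ∀ a b, H.Adj a b → ((2 * ρ : ℕ) : ℕ∞) ≤ (H.deleteEdges {s(a, b)}).edist a b

/-- A walk in a graph with an additional edge can be replaced by one that uses it at most once. -/
lemma edist_le_length_of_sup_edge {K : SimpleGraph V} {u v a b : V}
    (p : (K ⊔ edge u v).Walk a b) :
    K.edist a b ≤ p.length ∨ K.edist a u + 1 + K.edist v b ≤ p.length ∨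
      K.edist a v + 1 + K.edist u b ≤ p.length := by
  induction p with
  | nil => simp
  | @cons a c b h p ih =>
    have hp : ((Walk.cons h p).length : ℕ∞) = p.length + 1 := by simp
    rw [hp]
    rcases (sup_adj _ _ _ _).1 h with hK | hE
    · have h1 : ∀ w, K.edist a w ≤ 1 + K.edist c w := by
        intro w
        have := K.edist_triangle (u := a) (v := c) (w := w)
        rwa [edist_eq_one_iff_adj.2 hK] at this
      rcases ih with h2 | h2 | h2
      · refine Or.inl ((h1 b).trans ?_)
        rw [add_comm]
        gcongr
      · refine Or.inr (Or.inl ?_)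
        calc K.edist a u + 1 + K.edist v b ≤ (1 + K.edist c u) + 1 + K.edist v b := by
              gcongr; exact h1 u
          _ = (K.edist c u + 1 + K.edist v b) + 1 := by ring
          _ ≤ p.length + 1 := by gcongr
      · refine Or.inr (Or.inr ?_)
        calc K.edist a v + 1 + K.edist u b ≤ (1 + K.edist c v) + 1 + K.edist u b := by
              gcongr; exact h1 v
          _ = (K.edist c v + 1 + K.edist u b) + 1 := by ring
          _ ≤ p.length + 1 := by gcongr
    · have le1 : ∀ x y z : ℕ∞, x + 1 + y ≤ z → y ≤ z + 1 := by
        intro x y z hxy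
        exact (le_add_self.trans hxy).trans le_self_add
      have le2 : ∀ x y z : ℕ∞, x + 1 + y ≤ z → 0 + 1 + y ≤ z + 1 := by
        intro x y z hxy
        have : y ≤ z := le_add_self.trans hxy
        rw [zero_add, add_comm]
        gcongr
      rcases (edge_adj ..).1 hE with ⟨⟨rfl, rfl⟩ | ⟨rfl, rfl⟩, -⟩
      · rcases ih with h2 | h2 | h2
        · refine Or.inr (Or.inl ?_)
          rw [edist_self, zero_add, add_comm]
          gcongr
        · refine Or.inr (Or.inl ?_)
          rw [edist_self]
          exact le2 _ _ _ h2
        · exact Or.inl (le1 _ _ _ h2)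
      · rcases ih with h2 | h2 | h2
        · refine Or.inr (Or.inr ?_)
          rw [edist_self, zero_add, add_comm]
          gcongr
        · exact Or.inl (le1 _ _ _ h2)
        · refine Or.inr (Or.inr ?_)
          rw [edist_self]
          exact le2 _ _ _ h2

lemma le_edist_iff_forall_walk {G : SimpleGraph V} {a b : V} {k : ℕ∞} :
    k ≤ G.edist a b ↔ ∀ p : G.Walk a b, k ≤ p.length := by
  constructor
  · exact fun h p => h.trans (G.edist_le p)
  · intro h
    by_cases htop : G.edist a b = ⊤
    · rw [htop]; exact le_top
    · obtain ⟨p, hp⟩ := exists_walk_of_edist_ne_top htop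
      rw [← hp]
      exact h p

/-- Adding an edge between distant vertices creates no short cycle. -/
lemma NoShortCycle.sup_edge {H : SimpleGraph V} {ρ : ℕ} (hH : H.NoShortCycle ρ) {u v : V}
    (huv : ((2 * ρ : ℕ) : ℕ∞) ≤ H.edist u v) (hadj : ¬ H.Adj u v) :
    (H ⊔ edge u v).NoShortCycle ρ := by
  intro a b hab
  by_cases he : s(a, b) = s(u, v)
  · have hle : (H ⊔ edge u v).deleteEdges {s(a, b)} ≤ H := by
      intro x y hxy
      rw [deleteEdges_adj, sup_adj, edge_adj, Set.mem_singleton_iff, he, Sym2.eq_iff] at hxy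
      tauto
    have h1 : ((2 * ρ : ℕ) : ℕ∞) ≤ H.edist a b := by
      rcases Sym2.eq_iff.1 he with ⟨rfl, rfl⟩ | ⟨rfl, rfl⟩
      · exact huv
      · rwa [edist_comm]
    exact h1.trans (edist_anti hle)
  · have hab' : H.Adj a b := by
      rcases (sup_adj _ _ _ _).1 hab with h | h
      · exact h
      · exact absurd (Sym2.eq_iff.2 ((edge_adj ..).1 h).1) he
    have hle : (H ⊔ edge u v).deleteEdges {s(a, b)} ≤ H.deleteEdges {s(a, b)} ⊔ edge u v := by
      intro x y hxy
      rw [deleteEdges_adj, sup_adj] at hxy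
      rw [sup_adj, deleteEdges_adj]
      tauto
    refine le_trans ?_ (edist_anti hle)
    rw [le_edist_iff_forall_walk]
    intro p
    have h0 : ∀ x y, H.edist x y ≤ (H.deleteEdges {s(a, b)}).edist x y :=
      fun x y => edist_anti (deleteEdges_le _)
    have hone : H.edist a b = 1 := edist_eq_one_iff_adj.2 hab'
    rcases edist_le_length_of_sup_edge p with h1 | h1 | h1
    · exact (hH a b hab').trans h1
    · refine huv.trans (le_trans ?_ h1)
      calc H.edist u v ≤ H.edist u a + (H.edist a b + H.edist b v) :=
            H.edist_triangle.trans (add_le_add le_rfl H.edist_triangle)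
        _ = H.edist a u + 1 + H.edist v b := by
            rw [hone, H.edist_comm (u := u), H.edist_comm (u := b), add_assoc]
        _ ≤ _ := add_le_add (add_le_add (h0 _ _) le_rfl) (h0 _ _)
    · refine huv.trans (le_trans ?_ h1)
      calc H.edist u v ≤ H.edist u b + (H.edist b a + H.edist a v) :=
            H.edist_triangle.trans (add_le_add le_rfl H.edist_triangle)
        _ = H.edist a v + 1 + H.edist u b := by
            rw [H.edist_comm (u := b), hone]; ring
        _ ≤ _ := add_le_add (add_le_add (h0 _ _) le_rfl) (h0 _ _)

lemma noShortCycle_bot (ρ : ℕ) : (⊥ : SimpleGraph V).NoShortCycle ρ := by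
  intro a b hab
  simp at hab

lemma noShortCycle_top : (⊤ : SimpleGraph V).NoShortCycle 1 := by
  intro a b hab
  have h1 : ¬ ((⊤ : SimpleGraph V).deleteEdges {s(a, b)}).edist a b ≤ 1 := by
    rw [edist_le_one_iff_adj_or_eq, deleteEdges_adj]
    simp [hab.ne]
  exact Order.add_one_le_of_lt (not_le.1 h1)

lemma IsAcyclic.noShortCycle {H : SimpleGraph V} (hH : H.IsAcyclic) (ρ : ℕ) :
    H.NoShortCycle ρ := by
  intro a b hab
  have h1 := isBridge_iff.1 (isAcyclic_iff_forall_adj_isBridge.1 hH hab)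
  rw [edist_eq_top_of_not_reachable h1]
  exact le_top

open Classical in
/-- In a graph of maximum degree `D`, a ball of radius `r` has at most `(D + 1) ^ r` elements. -/
lemma card_ball_le [Fintype V] {H : SimpleGraph V} {D : ℕ} (hD : ∀ v, H.degree v ≤ D) (u : V)
    (r : ℕ) :
    (Finset.univ.filter fun v => ∃ p : H.Walk v u, p.length ≤ r).card ≤ (D + 1) ^ r := by
  induction r with
  | zero =>
    rw [pow_zero, Finset.card_le_one]
    intro v hv w hw
    simp only [Finset.mem_filter, Finset.mem_univ, true_and, Nat.le_zero] at hv hw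
    obtain ⟨p, hp⟩ := hv
    obtain ⟨q, hq⟩ := hw
    rw [Walk.eq_of_length_eq_zero hp, Walk.eq_of_length_eq_zero hq]
  | succ r ih =>
    have hsub : (Finset.univ.filter fun v => ∃ p : H.Walk v u, p.length ≤ r + 1) ⊆
        (Finset.univ.filter fun v => ∃ p : H.Walk v u, p.length ≤ r).biUnion
          fun y => insert y (H.neighborFinset y) := by
      intro v hv
      simp only [Finset.mem_filter, Finset.mem_univ, true_and, Finset.mem_biUnion,
        Finset.mem_insert, mem_neighborFinset] at hv ⊢
      obtain ⟨p, hp⟩ := hv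
      cases p with
      | nil => exact ⟨u, ⟨Walk.nil, by simp⟩, Or.inl rfl⟩
      | @cons _ w _ h q =>
        rw [Walk.length_cons] at hp
        exact ⟨w, ⟨q, by omega⟩, Or.inr h.symm⟩
    refine (Finset.card_le_card hsub).trans ?_
    refine (Finset.card_biUnion_le_card_mul _ _ (D + 1) fun y _ => ?_).trans ?_
    · refine (Finset.card_insert_le _ _).trans ?_
      rw [card_neighborFinset_eq_degree]
      exact Nat.succ_le_succ (hD y)
    · rw [pow_succ]
      exact Nat.mul_le_mul_right _ ih

open Classical in
/-- A maximal graph of maximum degree at most `D` without short cycles has many edges: its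
vertices of degree less than `D` all lie in one ball of radius less than `2 * ρ`. -/
lemma exists_noShortCycle_of_le [Fintype V] {ρ D : ℕ} (hρ : 1 ≤ ρ)
    (hcard : 2 * (D + 1) ^ (2 * ρ) ≤ Fintype.card V) :
    ∃ H : SimpleGraph V, H.NoShortCycle ρ ∧ Fintype.card V * D ≤ 4 * H.edgeFinset.card := by
  obtain ⟨H, hmax⟩ := (Set.toFinite
    {H : SimpleGraph V | H.NoShortCycle ρ ∧ ∀ v, H.degree v ≤ D}).exists_maximal
    ⟨⊥, noShortCycle_bot ρ, fun v => by simp⟩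
  obtain ⟨⟨hH, hD⟩, hmax⟩ := hmax
  refine ⟨H, hH, ?_⟩
  set S := Finset.univ.filter fun v => H.degree v < D with hS
  have hSmem : ∀ v, v ∈ S ↔ H.degree v < D := by simp [hS]
  have hclose : ∀ u ∈ S, ∀ v ∈ S, ∃ p : H.Walk v u, p.length ≤ 2 * ρ := by
    intro u hu v hv
    by_contra! hno
    rw [hSmem] at hu hv
    have huv : u ≠ v := by
      rintro rfl
      exact absurd (hno Walk.nil) (by simp)
    have hadj : ¬ H.Adj u v := by
      intro hadj
      have := hno hadj.symm.toWalk
      simp at this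
      omega
    have hfar : ((2 * ρ : ℕ) : ℕ∞) ≤ H.edist u v := by
      rw [edist_comm, le_edist_iff_forall_walk]
      intro p
      exact_mod_cast (hno p).le
    have hdeg : ∀ w, (H ⊔ edge u v).degree w ≤ D := by
      intro w
      have hsub : (H ⊔ edge u v).neighborFinset w ⊆ H.neighborFinset w ∪
          (if w = u then {v} else if w = v then {u} else ∅) := by
        intro x hx
        rw [mem_neighborFinset, sup_adj, edge_adj] at hx
        rw [Finset.mem_union, mem_neighborFinset]
        rcases hx with hx | ⟨⟨rfl, rfl⟩ | ⟨rfl, rfl⟩, hne⟩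
        · exact Or.inl hx
        · simp
        · simp [hne]
      have h1 := (Finset.card_le_card hsub).trans (Finset.card_union_le _ _)
      rw [card_neighborFinset_eq_degree, card_neighborFinset_eq_degree] at h1
      refine h1.trans ?_
      split_ifs with h2 h3
      · subst h2; rw [Finset.card_singleton]; omega
      · subst h3; rw [Finset.card_singleton]; omega
      · simpa using hD w
    have hle := hmax ⟨hH.sup_edge hfar hadj, fun w => by convert hdeg w⟩ le_sup_left
    refine hadj (hle ?_)
    rw [sup_adj, edge_adj]
    exact Or.inr ⟨Or.inl ⟨rfl, rfl⟩, huv⟩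
  have hScard : S.card ≤ (D + 1) ^ (2 * ρ) := by
    rcases S.eq_empty_or_nonempty with h0 | ⟨u, hu⟩
    · rw [h0]; simp
    · refine le_trans (Finset.card_le_card ?_) (card_ball_le hD u (2 * ρ))
      intro v hv
      simpa using hclose u hu v hv
  have hsum : (Finset.univ \ S).card * D ≤ 2 * H.edgeFinset.card := by
    rw [← H.sum_degrees_eq_twice_card_edges]
    calc (Finset.univ \ S).card * D ≤ ∑ v ∈ Finset.univ \ S, H.degree v := by
          rw [← smul_eq_mul]
          refine Finset.card_nsmul_le_sum _ _ _ fun v hv => ?_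
          have := (Finset.mem_sdiff.1 hv).2
          rw [hSmem] at this
          omega
      _ ≤ ∑ v, H.degree v :=
          Finset.sum_le_sum_of_subset (Finset.subset_univ _)
  have hcompl : (Finset.univ \ S).card + S.card = Fintype.card V := by
    rw [Finset.card_sdiff_add_card_eq_card (Finset.subset_univ S), Finset.card_univ]
  have : Fintype.card V ≤ 2 * (Finset.univ \ S).card := by omega
  calc Fintype.card V * D ≤ 2 * (Finset.univ \ S).card * D := Nat.mul_le_mul_right _ this
    _ = 2 * ((Finset.univ \ S).card * D) := by ring
    _ ≤ 4 * H.edgeFinset.card := by omega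

open Classical in
/-- For all `N ≥ 2` and `ρ ≥ 1` there is a graph on `N` vertices without cycles of length at most
`2 * ρ` that has at least `N ^ (1 + 1 / (2 * ρ)) / 24` edges. -/
lemma exists_noShortCycle {N ρ : ℕ} (hN : 2 ≤ N) (hρ : 1 ≤ ρ) :
    ∃ H : SimpleGraph (Fin N), H.NoShortCycle ρ ∧
      (N : ℝ) ^ (1 + 1 / 2 / (ρ : ℝ)) ≤ 24 * H.edgeFinset.card := by
  have hN0 : (0 : ℝ) < N := by exact_mod_cast (by omega : 0 < N)
  have hexp : (1 : ℝ) / 2 / ρ = ((2 * ρ : ℕ) : ℝ)⁻¹ := by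
    push_cast
    rw [mul_inv, div_eq_mul_inv, one_div]
  have hroot : ∀ D : ℕ, N ≤ D ^ (2 * ρ) → (N : ℝ) ^ (1 + 1 / 2 / (ρ : ℝ)) ≤ N * D := by
    intro D hD
    rw [Real.rpow_add hN0, Real.rpow_one, hexp]
    gcongr
    rw [← Real.pow_rpow_inv_natCast (Nat.cast_nonneg D) (show 2 * ρ ≠ 0 by omega)]
    apply Real.rpow_le_rpow hN0.le _ (by positivity)
    exact_mod_cast hD
  by_cases hbig : 2 * (1 + 1) ^ (2 * ρ) ≤ N
  · set D := Nat.findGreatest (fun D => 2 * (D + 1) ^ (2 * ρ) ≤ N) N with hDdef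
    have hD1 : 1 ≤ D := Nat.le_findGreatest (by omega) hbig
    have hD : 2 * (D + 1) ^ (2 * ρ) ≤ N := Nat.findGreatest_spec (P := fun D =>
      2 * (D + 1) ^ (2 * ρ) ≤ N) (show 1 ≤ N by omega) hbig
    have hDN : D + 1 ≤ N := by
      have : D + 1 ≤ (D + 1) ^ (2 * ρ) := Nat.le_self_pow (by omega) _
      omega
    have hD' : N < 2 * (D + 1 + 1) ^ (2 * ρ) :=
      not_le.1 (Nat.findGreatest_is_greatest (P := fun D => 2 * (D + 1) ^ (2 * ρ) ≤ N)
        (Nat.lt_succ_self D) hDN)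
    obtain ⟨H, hH, hedges⟩ := exists_noShortCycle_of_le (V := Fin N) hρ (by simpa using hD)
    rw [Fintype.card_fin] at hedges
    refine ⟨H, hH, (hroot (6 * D) ?_).trans ?_⟩
    · calc N ≤ 2 * (D + 1 + 1) ^ (2 * ρ) := hD'.le
        _ ≤ 2 ^ (2 * ρ) * (3 * D) ^ (2 * ρ) :=
          Nat.mul_le_mul (Nat.le_self_pow (by omega) _) (Nat.pow_le_pow_left (by omega) _)
        _ = (6 * D) ^ (2 * ρ) := by rw [← mul_pow]; congr 1; ring
    · have : ((N * D : ℕ) : ℝ) ≤ ((4 * H.edgeFinset.card : ℕ) : ℝ) := by exact_mod_cast hedges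
      push_cast at this ⊢
      linarith
  · have : Nonempty (Fin N) := ⟨⟨0, by omega⟩⟩
    obtain ⟨H, -, hH⟩ := (connected_top (V := Fin N)).exists_isTree_le
    have hedges := hH.card_edgeFinset
    rw [Fintype.card_fin] at hedges
    refine ⟨H, hH.isAcyclic.noShortCycle ρ, (hroot 4 ?_).trans ?_⟩
    · calc N ≤ 2 * (1 + 1) ^ (2 * ρ) := (not_le.1 hbig).le
        _ ≤ 2 ^ (2 * ρ) * 2 ^ (2 * ρ) := Nat.mul_le_mul_right _ (Nat.le_self_pow (by omega) _)
        _ = 4 ^ (2 * ρ) := by rw [← mul_pow]; rfl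
    · have : (N : ℝ) = H.edgeFinset.card + 1 := by
        exact_mod_cast hedges.symm
      have h2 : (2 : ℝ) ≤ N := by exact_mod_cast hN
      push_cast
      linarith

end SimpleGraph

/-! ### Recognizing BFS trees by levels -/

/-- Following the parents leads to the root within as many steps as the level says. -/
lemma SimpleGraph.exists_walk_length_le_level {V : Type*} {G : SimpleGraph V}
    {T : V → V → Prop} {root : V} {level : V → ℕ} (hT : ∀ p v, T p v → G.Adj p v)
    (hlevel : ∀ p v, T p v → level v = level p + 1)
    (hparent : ∀ v, v ≠ root → ∃ p, T p v) (v : V) :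
    ∃ p : G.Walk v root, p.length ≤ level v := by
  induction hl : level v generalizing v with
  | zero =>
    have hv : v = root := by
      by_contra hv
      obtain ⟨p, hp⟩ := hparent v hv
      have := hlevel p v hp
      omega
    subst hv
    exact ⟨SimpleGraph.Walk.nil, by simp⟩
  | succ l ih =>
    by_cases hv : v = root
    · subst hv
      exact ⟨SimpleGraph.Walk.nil, by simp⟩
    · obtain ⟨p, hp⟩ := hparent v hv
      have := hlevel p v hp
      obtain ⟨q, hq⟩ := ih p (by omega)
      exact ⟨SimpleGraph.Walk.cons (hT p v hp).symm q, by simpa using hq⟩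

lemma SimpleGraph.connected_of_parent {V : Type*} {G : SimpleGraph V}
    {T : V → V → Prop} {root : V} {level : V → ℕ} (hT : ∀ p v, T p v → G.Adj p v)
    (hlevel : ∀ p v, T p v → level v = level p + 1)
    (hparent : ∀ v, v ≠ root → ∃ p, T p v) : G.Connected := by
  rw [SimpleGraph.connected_iff_exists_forall_reachable]
  exact ⟨root, fun v =>
    (SimpleGraph.exists_walk_length_le_level hT hlevel hparent v).choose.reachable.symm⟩

namespace BFSInput

variable {n : ℕ} {I : BFSInput n}

lemma treeGraph_adj_of_tree {p v : Fin n} (h : I.tree p v) : I.treeGraph.Adj p v :=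
  (SimpleGraph.fromRel_adj _ _ _).2 ⟨(I.tree_adj _ _ h).ne, Or.inl h⟩

variable {level : Fin n → ℕ}

lemma treeGraph_connected (hlevel : ∀ p v, I.tree p v → level v = level p + 1)
    (hparent : ∀ v, v ≠ I.root → ∃ p, I.tree p v) : I.treeGraph.Connected :=
  SimpleGraph.connected_of_parent (fun _ _ => treeGraph_adj_of_tree) hlevel hparent

lemma treeGraph_dist_root (hroot : level I.root = 0)
    (hlevel : ∀ p v, I.tree p v → level v = level p + 1)
    (hparent : ∀ v, v ≠ I.root → ∃ p, I.tree p v) (v : Fin n) :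
    I.treeGraph.dist I.root v = level v := by
  refine le_antisymm ?_ ?_
  · obtain ⟨p, hp⟩ := SimpleGraph.exists_walk_length_le_level
      (fun _ _ => treeGraph_adj_of_tree (I := I)) hlevel hparent v
    rw [SimpleGraph.dist_comm]
    exact (I.treeGraph.dist_le p).trans hp
  · have := (treeGraph_connected hlevel hparent).le_add_dist (f := level) (fun x y hxy => by
      rcases ((SimpleGraph.fromRel_adj _ _ _).1 hxy).2 with h | h
      · exact (hlevel _ _ h).le
      · have := hlevel _ _ h
        omega) I.root v
    omega

lemma treeGraph_isTree (hlevel : ∀ p v, I.tree p v → level v = level p + 1)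
    (hroot : level I.root = 0)
    (hparent : ∀ v, v ≠ I.root → ∃ p, I.tree p v)
    (hunique : ∀ p p' v, I.tree p v → I.tree p' v → p = p') : I.treeGraph.IsTree := by
  have hconn := treeGraph_connected hlevel hparent
  rw [SimpleGraph.isTree_iff_connected_and_card]
  refine ⟨hconn, le_antisymm ?_ hconn.card_vert_le_card_edgeSet_add_one⟩
  choose! par hpar using hparent
  have hsub : I.treeGraph.edgeSet ⊆ (fun v => s(par v, v)) '' {I.root}ᶜ := by
    intro s hs
    induction s with
    | h x y =>
      have key : ∀ a b, I.tree a b → b ∈ ({I.root}ᶜ : Set (Fin n)) ∧ par b = a := by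
        intro a b hab
        have hb : b ≠ I.root := by
          rintro rfl
          have := hlevel _ _ hab
          omega
        exact ⟨hb, hunique _ _ _ (hpar b hb) hab⟩
      rcases ((SimpleGraph.fromRel_adj _ x y).1 hs).2 with h | h
      · exact ⟨y, (key x y h).1, congrArg (fun a => s(a, y)) (key x y h).2⟩
      · exact ⟨x, (key y x h).1, (congrArg (fun a => s(a, x)) (key y x h).2).trans Sym2.eq_swap⟩
  have h1 := (Set.ncard_le_ncard hsub (Set.toFinite _)).trans (Set.ncard_image_le (Set.toFinite _))
  have h2 := Set.ncard_add_ncard_compl ({I.root} : Set (Fin n))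
  rw [Set.ncard_singleton] at h2
  rw [Nat.card_coe_set_eq]
  omega

/-- A labelled tree whose levels grow by at most one along every edge of the network is a BFS
tree. -/
lemma isApproxBFSTree_of_level {d : ℝ} (hd : 1 ≤ d) (hroot : level I.root = 0)
    (hlevel : ∀ p v, I.tree p v → level v = level p + 1)
    (hparent : ∀ v, v ≠ I.root → ∃ p, I.tree p v)
    (hunique : ∀ p p' v, I.tree p v → I.tree p' v → p = p')
    (hadj : ∀ x y, I.graph.Adj x y → level y ≤ level x + 1) : I.IsApproxBFSTree d := by
  refine ⟨treeGraph_isTree hlevel hroot hparent hunique, ?_, ?_⟩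
  · intro p v hpv
    rw [treeGraph_dist_root hroot hlevel hparent, treeGraph_dist_root hroot hlevel hparent,
      hlevel p v hpv]
  · intro v
    rw [treeGraph_dist_root hroot hlevel hparent]
    have h1 := I.connected.le_add_dist hadj I.root v
    rw [hroot, zero_add] at h1
    have h2 : (level v : ℝ) ≤ I.graph.dist I.root v := by exact_mod_cast h1
    have h3 : (0 : ℝ) ≤ I.graph.dist I.root v := by positivity
    nlinarith

lemma graph_dist_root_le (hlevel : ∀ p v, I.tree p v → level v = level p + 1)
    (hparent : ∀ v, v ≠ I.root → ∃ p, I.tree p v) (v : Fin n) :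
    I.graph.dist I.root v ≤ level v := by
  obtain ⟨p, hp⟩ := SimpleGraph.exists_walk_length_le_level I.tree_adj hlevel hparent v
  rw [SimpleGraph.dist_comm]
  exact (I.graph.dist_le p).trans hp

/-- A shortcut to a node of large level shows that the labelled tree is not an approximate BFS
tree. -/
lemma not_isApproxBFSTree_of_adj {d : ℝ} (hd : 0 ≤ d) (hroot : level I.root = 0)
    (hlevel : ∀ p v, I.tree p v → level v = level p + 1)
    (hparent : ∀ v, v ≠ I.root → ∃ p, I.tree p v) {u v : Fin n} (huv : I.graph.Adj u v)
    (hlt : d * (level u + 1) < level v) : ¬ I.IsApproxBFSTree d := by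
  rintro ⟨-, -, h⟩
  have h1 := h v
  rw [treeGraph_dist_root hroot hlevel hparent] at h1
  have h2 := graph_dist_root_le hlevel hparent u
  have h3 := I.connected.dist_le_dist_add_one I.root huv
  have h4 : (I.graph.dist I.root v : ℝ) ≤ level u + 1 := by exact_mod_cast (by omega)
  have h5 := mul_le_mul_of_nonneg_left h4 hd
  linarith

end BFSInput

/-! ### Two spiders joined by a path -/

/-- The nodes of the lower-bound network: `Sum.inl (j, w, h)` is the node at height `h` (counted
from the center) on the leg `w` of the spider `j`, and `Sum.inr t` is the node at position `t` of
the path that joins the centers of the spiders. Its first node is the center of spider `false`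
and its last node the center of spider `true`. The node of largest height on a leg is its tip. -/
abbrev SpiderNode (N ρ L : ℕ) : Type := (Bool × Fin N × Fin ρ) ⊕ Fin (L + 1)

namespace SpiderNode

variable {N ρ L : ℕ}

/-- The position on the path of the center of a spider. -/
def center (L : ℕ) (j : Bool) : ℕ := if j then L else 0

/-- The spanning tree, directed away from the first node of the path. -/
def treeRel : SpiderNode N ρ L → SpiderNode N ρ L → Prop
  | .inl (j, w, h), .inl (j', w', h') => j = j' ∧ w = w' ∧ h.val + 1 = h'.val
  | .inr t, .inl (j, _, h) => h.val = 0 ∧ t.val = center L j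
  | .inr t, .inr t' => t.val + 1 = t'.val
  | .inl _, .inr _ => False

/-- The tips of two legs of the same spider, where `P` holds of the legs. -/
def tipRel (P : Fin N → Fin N → Prop) : SpiderNode N ρ L → SpiderNode N ρ L → Prop
  | .inl (j, w, h), .inl (j', w', h') => j = j' ∧ h.val + 1 = ρ ∧ h'.val + 1 = ρ ∧ P w w'
  | _, _ => False

/-- The distance from the first node of the path in the tree. -/
def level : SpiderNode N ρ L → ℕ
  | .inl (j, _, h) => center L j + h.val + 1
  | .inr t => t.val

/-- The height above the path. -/
def height : SpiderNode N ρ L → ℕ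
  | .inl (_, _, h) => h.val + 1
  | .inr _ => 0

/-- The symmetry that exchanges the spiders and reverses the path. -/
def mirror : SpiderNode N ρ L → SpiderNode N ρ L
  | .inl (j, w, h) => .inl (!j, w, h)
  | .inr t => .inr t.rev

/-- The identifiers: corresponding nodes of the two spiders have consecutive ones. -/
def ident : SpiderNode N ρ L → ℕ
  | .inl (j, w, h) => 2 * (finProdFinEquiv (w, h)).val + (if j then 1 else 0)
  | .inr t => 2 * (N * ρ) + t.val

lemma mirror_mirror (x : SpiderNode N ρ L) : mirror (mirror x) = x := by
  rcases x with ⟨j, w, h⟩ | t <;> simp [mirror]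

lemma ident_injective : Function.Injective (ident : SpiderNode N ρ L → ℕ) := by
  rintro (⟨j, w, h⟩ | t) (⟨j', w', h'⟩ | t') heq
  · have h1 : (finProdFinEquiv (w, h)).val = (finProdFinEquiv (w', h')).val := by
      simp only [ident] at heq
      split_ifs at heq <;> omega
    have h2 := finProdFinEquiv.injective (Fin.ext h1)
    simp only [ident, h2] at heq
    rw [Prod.mk.injEq] at h2
    obtain ⟨rfl, rfl⟩ := h2
    cases j <;> cases j' <;> simp_all
  · have h1 := (finProdFinEquiv (w, h)).isLt
    simp only [ident] at heq
    split_ifs at heq <;> omega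
  · have h1 := (finProdFinEquiv (w', h')).isLt
    simp only [ident] at heq
    split_ifs at heq <;> omega
  · simp only [ident] at heq
    congr 1
    ext
    omega

lemma ident_lt (x : SpiderNode N ρ L) : ident x < 2 * (N * ρ) + (L + 1) := by
  rcases x with ⟨j, w, h⟩ | t
  · have h1 := (finProdFinEquiv (w, h)).isLt
    simp only [ident]
    split_ifs <;> omega
  · have := t.isLt
    simp only [ident]
    omega

lemma level_of_treeRel {x y : SpiderNode N ρ L} (h : treeRel x y) : level y = level x + 1 := by
  rcases x with ⟨j, w, h⟩ | t <;> rcases y with ⟨j', w', h'⟩ | t' <;>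
    simp only [treeRel, level] at h ⊢
  · obtain ⟨rfl, rfl, h1⟩ := h
    omega
  · omega
  · omega

lemma exists_treeRel {y : SpiderNode N ρ L} (hy : y ≠ .inr 0) : ∃ x, treeRel x y := by
  rcases y with ⟨j, w, h⟩ | t
  · by_cases h0 : h.val = 0
    · refine ⟨.inr ⟨center L j, ?_⟩, h0, rfl⟩
      unfold center
      split_ifs <;> omega
    · exact ⟨.inl (j, w, ⟨h.val - 1, by omega⟩), rfl, rfl, by simp only; omega⟩
  · have h0 : t.val ≠ 0 := fun h0 => hy (by congr 1; ext; simpa using h0)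
    exact ⟨.inr ⟨t.val - 1, by omega⟩, by simp only [treeRel]; omega⟩

lemma treeRel_unique {x x' y : SpiderNode N ρ L} (h : treeRel x y) (h' : treeRel x' y) :
    x = x' := by
  rcases x with ⟨j, w, h⟩ | t <;> rcases x' with ⟨j', w', h'⟩ | t' <;>
    rcases y with ⟨j'', w'', h''⟩ | t'' <;> simp only [treeRel] at h h'
  · obtain ⟨rfl, rfl, h1⟩ := h
    obtain ⟨rfl, rfl, h2⟩ := h'
    congr 3
    ext
    omega
  · omega
  · omega
  · congr 1
    ext
    omega
  · congr 1
    ext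
    omega

/-- Adjacency in the network in which the tips of both spiders are joined according to `H`. -/
def netAdj (H : SimpleGraph (Fin N)) (x y : SpiderNode N ρ L) : Prop :=
  treeRel x y ∨ treeRel y x ∨ tipRel H.Adj x y

lemma tipRel_symm {P : Fin N → Fin N → Prop} (hP : ∀ a b, P a b → P b a)
    {x y : SpiderNode N ρ L} (h : tipRel P x y) : tipRel P y x := by
  rcases x with ⟨j, w, h⟩ | t <;> rcases y with ⟨j', w', h'⟩ | t' <;> simp only [tipRel] at h ⊢
  exact ⟨h.1.symm, h.2.2.1, h.2.1, hP _ _ h.2.2.2⟩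

lemma tipRel_mirror {P : Fin N → Fin N → Prop} {x y : SpiderNode N ρ L} (h : tipRel P x y) :
    tipRel P (mirror x) (mirror y) := by
  rcases x with ⟨j, w, h⟩ | t <;> rcases y with ⟨j', w', h'⟩ | t' <;>
    simp only [tipRel, mirror] at h ⊢
  simpa using h

lemma treeRel_mirror {x y : SpiderNode N ρ L} (h : treeRel x y) :
    treeRel (mirror x) (mirror y) ∨ treeRel (mirror y) (mirror x) := by
  rcases x with ⟨j, w, h⟩ | t <;> rcases y with ⟨j', w', h'⟩ | t' <;>
    simp only [treeRel, mirror, Fin.val_rev] at h ⊢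
  · exact Or.inl (by simpa using h)
  · left
    refine ⟨h.1, ?_⟩
    have := h.2
    unfold center at this ⊢
    cases j' <;> simp only [Bool.not_true, Bool.not_false, if_true, if_false,
      Bool.false_eq_true] at this ⊢ <;> omega
  · omega

lemma netAdj_mirror {H : SimpleGraph (Fin N)} {x y : SpiderNode N ρ L} (h : netAdj H x y) :
    netAdj H (mirror x) (mirror y) := by
  rcases h with h | h | h
  · exact (treeRel_mirror h).elim Or.inl fun h => Or.inr (Or.inl h)
  · exact (treeRel_mirror h).elim (fun h => Or.inr (Or.inl h)) Or.inl
  · exact Or.inr (Or.inr (tipRel_mirror h))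

/-- To bound the growth of a function along the edges, it suffices to look at the edges of the
tree, in both directions, and at the edges between tips, in one. -/
lemma le_add_one_of_netAdj {H : SimpleGraph (Fin N)} {f : SpiderNode N ρ L → ℕ}
    (htree : ∀ x y, treeRel x y → f y ≤ f x + 1 ∧ f x ≤ f y + 1)
    (htip : ∀ x y, tipRel H.Adj x y → f y ≤ f x + 1) {x y : SpiderNode N ρ L}
    (h : netAdj H x y) : f y ≤ f x + 1 := by
  rcases h with h | h | h
  · exact (htree _ _ h).1
  · exact (htree _ _ h).2
  · exact htip _ _ h

lemma level_le_of_netAdj {H : SimpleGraph (Fin N)} {x y : SpiderNode N ρ L}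
    (h : netAdj H x y) : level y ≤ level x + 1 := by
  refine le_add_one_of_netAdj (fun x y h => ?_) (fun x y h => ?_) h
  · have := level_of_treeRel h
    omega
  · rcases x with ⟨j, w, h⟩ | t <;> rcases y with ⟨j', w', h'⟩ | t' <;>
      simp only [tipRel, level] at h ⊢
    obtain ⟨rfl, h1, h2, -⟩ := h
    omega

lemma height_le_of_netAdj {H : SimpleGraph (Fin N)} {x y : SpiderNode N ρ L}
    (h : netAdj H x y) : height y ≤ height x + 1 := by
  refine le_add_one_of_netAdj (fun x y h => ?_) (fun x y h => ?_) h
  all_goals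
    rcases x with ⟨j, w, h⟩ | t <;> rcases y with ⟨j', w', h'⟩ | t' <;>
      simp only [treeRel, tipRel, height] at h ⊢ <;> omega

/-- A function that separates the tips of two legs of spider `j`, if `D` does so for the legs: on a
leg it is `D`, pushed towards `ρ` when the height decreases, and it is `ρ` elsewhere. -/
def separator (D : Fin N → ℕ) (j : Bool) : SpiderNode N ρ L → ℕ
  | .inl (j', w, h) =>
    if j' = j then max (ρ - (h.val + 1)) (min (ρ + (h.val + 1)) (D w)) else ρ
  | .inr _ => ρ

lemma separator_le_of_netAdj {H : SimpleGraph (Fin N)} {D : Fin N → ℕ} {j : Bool}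
    (hD : ∀ w w', H.Adj w w' → D w' ≤ D w + 1) {x y : SpiderNode N ρ L}
    (h : netAdj H x y) : separator D j y ≤ separator D j x + 1 := by
  refine le_add_one_of_netAdj (fun x y h => ?_) (fun x y h => ?_) h
  · rcases x with ⟨j', w, h⟩ | t <;> rcases y with ⟨j'', w', h'⟩ | t' <;>
      simp only [treeRel, separator] at h ⊢
    · obtain ⟨rfl, rfl, h⟩ := h
      split_ifs <;> omega
    · split_ifs <;> omega
    · omega
  · rcases x with ⟨j', w, h⟩ | t <;> rcases y with ⟨j'', w', h'⟩ | t' <;>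
      simp only [tipRel, separator] at h ⊢
    obtain ⟨rfl, h1, h2, h3⟩ := h
    have := hD _ _ h3
    split_ifs <;> omega

end SpiderNode

namespace SpiderNode

variable {N ρ L n : ℕ}

lemma not_treeRel_self (x : SpiderNode N ρ L) : ¬ treeRel x x := fun h => by
  have := level_of_treeRel h
  omega

/-- Two spiders joined by a path, with edges between tips according to `H`. -/
def netGraph (H : SimpleGraph (Fin N)) : SimpleGraph (SpiderNode N ρ L) where
  Adj := netAdj H
  symm := ⟨fun x y h => by
    rcases h with h | h | h
    · exact Or.inr (Or.inl h)
    · exact Or.inl h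
    · exact Or.inr (Or.inr (tipRel_symm (fun _ _ h => h.symm) h))⟩
  loopless := ⟨fun x h => by
    rcases h with h | h | h
    · exact not_treeRel_self x h
    · exact not_treeRel_self x h
    · rcases x with ⟨j, w, h'⟩ | t <;> simp [tipRel] at h⟩

/-- The edges that join, in both spiders, the tips of the legs in the pair `s`. -/
def pairRel (s : Sym2 (Fin N)) : SpiderNode N ρ L → SpiderNode N ρ L → Prop :=
  tipRel fun w w' => s(w, w') = s

lemma pairRel_symm {s : Sym2 (Fin N)} {x y : SpiderNode N ρ L} (h : pairRel s x y) :
    pairRel s y x :=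
  tipRel_symm (fun _ _ h => Sym2.eq_swap.trans h) h

lemma pairRel_unique_right {s : Sym2 (Fin N)} {x y z : SpiderNode N ρ L} (hy : pairRel s x y)
    (hz : pairRel s x z) : y = z := by
  rcases x with ⟨j, w, h⟩ | t <;> rcases y with ⟨j₁, w₁, h₁⟩ | t₁ <;>
    rcases z with ⟨j₂, w₂, h₂⟩ | t₂ <;> simp only [pairRel, tipRel] at hy hz
  obtain ⟨rfl, -, h1, h2⟩ := hy
  obtain ⟨rfl, -, h3, h4⟩ := hz
  obtain rfl := Sym2.congr_right.1 (h2.trans h4.symm)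
  congr 3
  ext
  omega

lemma pairRel_unique {s s' : Sym2 (Fin N)} {x y : SpiderNode N ρ L} (h : pairRel s x y)
    (h' : pairRel s' x y) : s = s' := by
  rcases x with ⟨j, w, hh⟩ | t <;> rcases y with ⟨j', w', hh'⟩ | t' <;>
    simp only [pairRel, tipRel] at h h'
  exact h.2.2.2.symm.trans h'.2.2.2

lemma not_pairRel_mirror {s : Sym2 (Fin N)} (x : SpiderNode N ρ L) :
    ¬ pairRel s (mirror x) x := by
  rcases x with ⟨j, w, h⟩ | t <;> simp [pairRel, tipRel, mirror]

lemma height_eq_of_pairRel {s : Sym2 (Fin N)} {x y : SpiderNode N ρ L} (h : pairRel s x y) :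
    height y = ρ := by
  rcases x with ⟨j, w, hh⟩ | t <;> rcases y with ⟨j', w', hh'⟩ | t' <;>
    simp only [pairRel, tipRel] at h
  exact h.2.2.1

lemma mirror_ne_of_height_pos {x : SpiderNode N ρ L} (h : 0 < height x) : x ≠ mirror x := by
  rcases x with ⟨j, w, hh⟩ | t
  · simp [mirror]
  · simp [height] at h

lemma height_mirror (x : SpiderNode N ρ L) : height (mirror x) = height x := by
  rcases x with ⟨j, w, hh⟩ | t <;> rfl

lemma ident_mirror {x : SpiderNode N ρ L} (h : 0 < height x) :
    ident (mirror x) = ident x + 1 ∨ ident x = ident (mirror x) + 1 := by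
  rcases x with ⟨j, w, hh⟩ | t
  · cases j <;> simp [ident, mirror]
  · simp [height] at h

lemma treeRel_mirror_iff {x y : SpiderNode N ρ L} (hx : 0 < height x) (hy : 0 < height y) :
    treeRel (mirror x) (mirror y) ↔ treeRel x y := by
  rcases x with ⟨j, w, h⟩ | t <;> rcases y with ⟨j', w', h'⟩ | t' <;>
    simp [height, mirror, treeRel] at hx hy ⊢

/-- The network after crossing the two edges of the pair `s`. -/
def crossedGraph (H : SimpleGraph (Fin N)) (s : Sym2 (Fin N)) :
    SimpleGraph (SpiderNode N ρ L) where
  Adj x y := netAdj (H.deleteEdges {s}) x y ∨ pairRel s x (mirror y)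
  symm := ⟨fun x y h => by
    rcases h with h | h
    · exact Or.inl ((netGraph (H.deleteEdges {s})).symm.symm _ _ h)
    · right
      have := tipRel_mirror (pairRel_symm h)
      rwa [mirror_mirror] at this⟩
  loopless := ⟨fun x h => by
    rcases h with h | h
    · exact (netGraph (H.deleteEdges {s})).irrefl h
    · rcases x with ⟨j, w, h'⟩ | t <;> simp [pairRel, tipRel, mirror] at h⟩

lemma netAdj_iff {H : SimpleGraph (Fin N)} {s : Sym2 (Fin N)} (hs : s ∈ H.edgeSet)
    (x y : SpiderNode N ρ L) :
    netAdj H x y ↔ netAdj (H.deleteEdges {s}) x y ∨ pairRel s x y := by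
  have key : tipRel H.Adj x y ↔ tipRel (H.deleteEdges {s}).Adj x y ∨ pairRel s x y := by
    rcases x with ⟨j, w, h⟩ | t <;> rcases y with ⟨j', w', h'⟩ | t' <;>
      simp only [tipRel, pairRel, or_false, SimpleGraph.deleteEdges_adj, Set.mem_singleton_iff]
    have : s(w, w') = s → H.Adj w w' := by
      rintro rfl
      exact hs
    tauto
  simp only [netAdj, key]
  tauto

lemma connected_comap (e : Fin n ≃ SpiderNode N ρ L) {K : SimpleGraph (SpiderNode N ρ L)}
    (hK : ∀ p v, treeRel p v → K.Adj p v) : (K.comap e).Connected := by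
  refine SimpleGraph.connected_of_parent (T := fun p v => treeRel (e p) (e v))
    (root := e.symm (.inr 0)) (level := fun v => level (e v)) (fun p v h => hK _ _ h)
    (fun p v h => level_of_treeRel h) fun v hv => ?_
  obtain ⟨x, hx⟩ := exists_treeRel (y := e v) fun h => hv (by rw [← h, e.symm_apply_apply])
  exact ⟨e.symm x, by rwa [e.apply_symm_apply]⟩

/-- The spanning tree of the two spiders, as a labelled subgraph of a network `K` whose nodes are
numbered by `e`. -/
def input (e : Fin n ≃ SpiderNode N ρ L) (K : SimpleGraph (SpiderNode N ρ L))
    (hK : ∀ p v, treeRel p v → K.Adj p v) : BFSInput n where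
  graph := K.comap e
  connected := connected_comap e hK
  id x := ident (e x)
  id_injective := ident_injective.comp e.injective
  root := e.symm (.inr 0)
  tree p v := treeRel (e p) (e v)
  tree_adj _ _ h := hK _ _ h

lemma exists_tree_input (e : Fin n ≃ SpiderNode N ρ L) {K : SimpleGraph (SpiderNode N ρ L)}
    (hK : ∀ p v, treeRel p v → K.Adj p v) (v : Fin n) (hv : v ≠ (input e K hK).root) :
    ∃ p, (input e K hK).tree p v := by
  obtain ⟨x, hx⟩ := exists_treeRel (y := e v) fun h => hv (by
    change v = e.symm (.inr 0)
    rw [← h, e.symm_apply_apply])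
  exact ⟨e.symm x, by simpa [input] using hx⟩

lemma level_root (e : Fin n ≃ SpiderNode N ρ L) {K : SimpleGraph (SpiderNode N ρ L)}
    (hK : ∀ p v, treeRel p v → K.Adj p v) : level (e (input e K hK).root) = 0 := by
  simp [input, level]

/-- Before crossing, the labelled tree is a BFS tree. -/
lemma isApproxBFSTree_input (e : Fin n ≃ SpiderNode N ρ L) (H : SimpleGraph (Fin N)) {d : ℝ}
    (hd : 1 ≤ d) : (input e (netGraph H) fun _ _ => Or.inl).IsApproxBFSTree d :=
  BFSInput.isApproxBFSTree_of_level (level := fun v => level (e v)) hd (level_root e _)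
    (fun _ _ h => level_of_treeRel h) (exists_tree_input e _)
    (fun _ _ _ h h' => e.injective (treeRel_unique h h')) fun _ _ h => level_le_of_netAdj h

/-- After crossing, a tip of the distant spider is close to the root in the network. -/
lemma not_isApproxBFSTree_input (e : Fin n ≃ SpiderNode N ρ L) (H : SimpleGraph (Fin N))
    (s : Sym2 (Fin N)) {d : ℝ} (hρ : 1 ≤ ρ) (hd : 0 ≤ d) (hlt : d * (ρ + 1) < L + ρ) :
    ¬ (input e (crossedGraph H s) fun _ _ h => Or.inl (Or.inl h)).IsApproxBFSTree d := by
  induction s with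
  | h a b =>
    refine BFSInput.not_isApproxBFSTree_of_adj (level := fun v => level (e v))
      (u := e.symm (.inl (false, a, ⟨ρ - 1, by omega⟩)))
      (v := e.symm (.inl (true, b, ⟨ρ - 1, by omega⟩))) hd (level_root e _)
      (fun _ _ h => level_of_treeRel h) (exists_tree_input e _) ?_ ?_
    · right
      simp only [Equiv.apply_symm_apply, mirror, pairRel, tipRel]
      refine ⟨rfl, ?_, ?_, trivial⟩ <;> omega
    · simp only [Equiv.apply_symm_apply, level, center]
      have h1 : (0 + (ρ - 1) + 1 : ℕ) = ρ := by omega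
      have h2 : (L + (ρ - 1) + 1 : ℕ) = L + ρ := by omega
      simp only [Bool.false_eq_true, if_false, if_true]
      rw [h1, h2]
      push_cast
      exact hlt

/-- The tips of two legs of a pair are far from each other if the edge between them is removed. -/
lemma le_dist_of_pairRel {H : SimpleGraph (Fin N)} {s : Sym2 (Fin N)}
    (hH : H.NoShortCycle ρ) (hs : s ∈ H.edgeSet) (hL : 2 * ρ ≤ L) (e : Fin n ≃ SpiderNode N ρ L)
    {a b c d : Fin n} (hab : pairRel s (e a) (e b)) (hcd : pairRel s (e c) (e d)) (hac : a ≠ c) :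
    2 * ρ ≤ ((netGraph (H.deleteEdges {s}) : SimpleGraph (SpiderNode N ρ L)).comap e).dist a c := by
  set G := (netGraph (H.deleteEdges {s}) : SimpleGraph (SpiderNode N ρ L)).comap e with hG
  have hconn : G.Connected := connected_comap e fun _ _ => Or.inl
  have hlev := hconn.le_add_dist (f := fun v => level (e v))
    fun x y hxy => level_le_of_netAdj hxy
  have hlev1 := hlev a c
  have hlev2 := hlev c a
  rw [G.dist_comm (u := c)] at hlev2
  have hne : e a ≠ e c := e.injective.ne hac
  rcases ha : e a with ⟨j, w, h⟩ | t <;> rcases hb : e b with ⟨j₁, w₁, h₁⟩ | t₁ <;>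
    rcases hc : e c with ⟨j₂, w₂, h₂⟩ | t₂ <;> rcases hd : e d with ⟨j₃, w₃, h₃⟩ | t₃ <;>
    simp only [ha, hb, hc, hd, pairRel, tipRel] at hab hcd
  simp only [ha, hc, level, center] at hlev1 hlev2
  obtain ⟨-, hh, -, hww⟩ := hab
  obtain ⟨-, hh₂, -, hww₂⟩ := hcd
  by_cases hj : j = j₂
  · subst hj
    have hw : w ≠ w₂ := by
      rintro rfl
      refine hne ?_
      rw [ha, hc]
      congr 3
      ext
      omega
    have hw₂ : w₂ = w₁ := by
      rw [← hww, Sym2.eq_iff] at hww₂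
      rcases hww₂ with h | h
      · exact absurd h.1.symm hw
      · exact h.1
    subst hw₂
    subst hww
    have hfar := hH w w₂ hs
    -- the distance from `w` in `H` without the edge, cut off at `2 * ρ`
    set K := H.deleteEdges {s(w, w₂)} with hK
    set D : Fin N → ℕ := fun v => (min ((2 * ρ : ℕ) : ℕ∞) (K.edist w v)).toNat with hD
    have hDcoe : ∀ v, (D v : ℕ∞) = min ((2 * ρ : ℕ) : ℕ∞) (K.edist w v) := fun v =>
      ENat.natCast_toNat (ne_top_of_le_ne_top (ENat.natCast_ne_top _) (min_le_left _ _))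
    have hDadj : ∀ v v', K.Adj v v' → D v' ≤ D v + 1 := by
      intro v v' hvv
      have h1 : K.edist w v' ≤ K.edist w v + 1 := by
        have := K.edist_triangle (u := w) (v := v) (w := v')
        rwa [SimpleGraph.edist_eq_one_iff_adj.2 hvv] at this
      have h2 : (D v' : ℕ∞) ≤ ((D v + 1 : ℕ) : ℕ∞) := by
        rw [Nat.cast_add, hDcoe, hDcoe, Nat.cast_one, ← min_add_add_right]
        exact min_le_min le_self_add h1
      exact_mod_cast h2
    have hDw : D w = 0 := by simp [hD]
    have hDw₂ : D w₂ = 2 * ρ := by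
      have := hDcoe w₂
      rw [min_eq_left hfar] at this
      exact_mod_cast this
    have := hconn.le_add_dist (f := fun v => separator D j (e v))
      (fun x y hxy => separator_le_of_netAdj hDadj hxy) a c
    simp only [ha, hc, separator, if_true, hDw, hDw₂] at this
    omega
  · cases j <;> cases j₂ <;> simp at hj hlev1 hlev2 <;> omega

/-- The inputs before and after crossing a pair of edges are twins. -/
lemma isTwin_input {H : SimpleGraph (Fin N)} {s : Sym2 (Fin N)} (hρ : 1 ≤ ρ)
    (hH : H.NoShortCycle ρ) (hs : s ∈ H.edgeSet) (hL : 2 * ρ ≤ L)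
    (e : Fin n ≃ SpiderNode N ρ L) :
    IsTwin (input e (netGraph H) fun _ _ => Or.inl)
      (input e (crossedGraph H s) fun _ _ h => Or.inl (Or.inl h))
      ((netGraph (H.deleteEdges {s})).comap e) (fun x => e.symm (mirror (e x)))
      (fun x y => pairRel s (e x) (e y)) {x | 0 < height (e x)} ρ where
  connected := connected_comap e fun _ _ => Or.inl
  pos := hρ
  invol x := by simp [mirror_mirror]
  adj x y h := by
    change netAdj _ _ _
    rw [e.apply_symm_apply, e.apply_symm_apply]
    exact netAdj_mirror h
  symm a b h := pairRel_symm h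
  equivariant a b h := by
    rw [e.apply_symm_apply, e.apply_symm_apply]
    exact tipRel_mirror h
  unique a b c hb hc := e.injective (pairRel_unique_right hb hc)
  ne a b h hab := by
    have hs' := ((netAdj_iff hs _ _).2 (Or.inr h))
    rw [hab] at hs'
    exact (netGraph H).irrefl hs'
  ne_swap a b h hab := by
    rw [hab, e.apply_symm_apply] at h
    exact not_pairRel_mirror _ h
  ne_self a b h hab := by
    have hpos : 0 < height (e a) := by
      rw [height_eq_of_pairRel (pairRel_symm h)]
      exact hρ
    have := congrArg e hab
    rw [e.apply_symm_apply] at this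
    exact mirror_ne_of_height_pos hpos this
  far a b c d hab hcd hac := le_dist_of_pairRel hH hs hL e hab hcd hac
  graph_adj x y := netAdj_iff hs _ _
  graph_adj' x y := by
    rw [e.apply_symm_apply]
    rfl
  id_eq := rfl
  root_eq := rfl
  tree_eq := rfl
  tree_le y z h := Or.inl h
  mem_of_dist_lt a b y hab hd := by
    have h1 := (connected_comap e (K := netGraph (H.deleteEdges {s}))
      fun _ _ => Or.inl).le_add_dist (f := fun v => height (e v))
      (fun x y hxy => height_le_of_netAdj hxy) y b
    have h2 := height_eq_of_pairRel hab
    rw [SimpleGraph.dist_comm] at h1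
    simp only [Set.mem_ofPred_eq]
    omega
  map_mem y h := by
    rwa [Set.mem_ofPred_eq, e.apply_symm_apply, height_mirror]
  id_map y h := by
    simp only [input, e.apply_symm_apply]
    exact ident_mirror h
  tree_map y z hy hz := by
    simp only [input, e.apply_symm_apply]
    exact treeRel_mirror_iff hy hz
  root_notMem := by simp [input, height]

/-- A graph `H` without short cycles gives a network on which every correct algorithm sends a
number of messages that is proportional to the number of edges of `H`. -/
lemma exists_input_card_le {B n k ρ N L : ℕ} {d ε : ℝ} {H : SimpleGraph (Fin N)}
    [Fintype H.edgeSet] (hH : H.NoShortCycle ρ) (hn : n = 2 * (N * ρ) + (L + 1)) (hk : 1 ≤ k) (hρ : 1 ≤ ρ)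
    (hL : 2 * ρ ≤ L) (hd : 1 ≤ d) (hlt : d * (ρ + 1) < L + ρ) (hε : ε ≤ 1 / 4)
    {A : ComparisonAlgorithm B} (hA : A.Solves n k ρ d ε) :
    ∃ I : BFSInput n, (∀ x, I.id x < n ^ k) ∧
      ENNReal.ofReal (H.edgeFinset.card / (2 * (1 + 4 * B * ρ))) ≤ A.expectedMessages I ρ := by
  have hcard : Fintype.card (SpiderNode N ρ L) = n := by
    rw [hn]
    simp
  set e : Fin n ≃ SpiderNode N ρ L := (Fintype.equivFinOfCardEq hcard).symm
  have hid : ∀ x, (input e (netGraph H) fun _ _ => Or.inl).id x < n ^ k := by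
    intro x
    have h1 := ident_lt (e x)
    have h2 : n ≤ n ^ k := Nat.le_self_pow (by omega) n
    change ident (e x) < n ^ k
    omega
  refine ⟨input e (netGraph H) fun _ _ => Or.inl, hid, ?_⟩
  have key := ComparisonAlgorithm.card_le_expectedMessages (E := H.edgeFinset) hε hA
    (fun s hs => isTwin_input hρ hH (SimpleGraph.mem_edgeFinset.1 hs) hL e)
    (fun s _ s' _ a b h h' => pairRel_unique h h') hid (isApproxBFSTree_input e H hd)
    (fun s _ => not_isApproxBFSTree_input e H s hρ (by linarith) hlt)
  have hpos : (0 : ℝ) < 1 + 4 * B * ρ := by positivity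
  rw [show (H.edgeFinset.card / (2 * (1 + 4 * B * ρ)) : ℝ) =
    (H.edgeFinset.card * 2⁻¹) / (1 + 4 * B * ρ) by field_simp,
    ENNReal.ofReal_div_of_pos hpos]
  refine ENNReal.div_le_of_le_mul' ?_
  refine le_trans (le_of_eq ?_) (key.trans (le_of_eq ?_))
  · rw [ENNReal.ofReal_mul (by positivity), ENNReal.ofReal_natCast,
      ENNReal.ofReal_inv_of_pos (by norm_num), ENNReal.ofReal_ofNat]
  · rw [← ENNReal.ofReal_natCast]
    push_cast
    rfl

end SpiderNode

/-! ### The choice of parameters -/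

/-- The bound for one round of knowledge: the tips of each spider form a complete graph. -/
lemma exists_input_of_radius_one {β ε d : ℝ} {B n k : ℕ} (hβ : 0 < β) (hβ1 : β < 1)
    (hε : ε ≤ 1 / 4) (hk : 1 ≤ k) (hn : 12 / β ≤ n) (hd : 1 ≤ d) (hd' : d * 2 ≤ (1 - β) * n)
    {A : ComparisonAlgorithm B} (hA : A.Solves n k 1 d ε) :
    ∃ I : BFSInput n, (∀ x, I.id x < n ^ k) ∧
      ENNReal.ofReal (β ^ 2 / (128 * (1 + 4 * B)) * (n : ℝ) ^ 2) ≤ A.expectedMessages I 1 := by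
  have hβn : 12 ≤ β * n := by
    rw [div_le_iff₀ hβ] at hn
    linarith
  have hn0 : (12 : ℝ) < n := by nlinarith
  -- `2 * N < β * n` leaves a path of length more than `(1 - β) * n - 1`
  set N := ⌊β * n / 3⌋₊ with hN
  have hN1 : (N : ℝ) ≤ β * n / 3 := Nat.floor_le (by positivity)
  have hN2 : β * n / 3 < N + 1 := Nat.lt_floor_add_one _
  have hNn : 2 * (N * 1) + 3 ≤ n := by
    have : (2 * (N * 1) + 3 : ℝ) ≤ n := by nlinarith
    exact_mod_cast this
  obtain ⟨L, hL⟩ : ∃ L, n = 2 * (N * 1) + (L + 1) := ⟨n - 2 * (N * 1) - 1, by omega⟩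
  have hLR : (n : ℝ) = 2 * N + (L + 1) := by exact_mod_cast (by omega : n = 2 * N + (L + 1))
  have hlt : d * (((1 : ℕ) : ℝ) + 1) < L + ((1 : ℕ) : ℝ) := by
    push_cast
    nlinarith
  obtain ⟨I, hid, hI⟩ := SpiderNode.exists_input_card_le (SimpleGraph.noShortCycle_top) hL hk
    le_rfl (by omega) hd hlt hε hA
  refine ⟨I, hid, le_trans (ENNReal.ofReal_le_ofReal ?_) hI⟩
  have hedges : ((⊤ : SimpleGraph (Fin N)).edgeFinset.card : ℝ) = N * (N - 1) / 2 := by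
    rw [SimpleGraph.card_edgeFinset_top_eq_card_choose_two, Fintype.card_fin,
      Nat.cast_choose_two]
  have hedges' : (β * n) ^ 2 / 64 ≤ ((⊤ : SimpleGraph (Fin N)).edgeFinset.card : ℝ) := by
    rw [hedges]
    nlinarith
  calc β ^ 2 / (128 * (1 + 4 * B)) * (n : ℝ) ^ 2
      = ((β * n) ^ 2 / 64) / (2 * (1 + 4 * B * ((1 : ℕ) : ℝ))) := by
        push_cast
        field_simp
        norm_num
    _ ≤ _ := div_le_div_of_nonneg_right hedges' (by positivity)

open Classical in
/-- The bound for larger radii: the tips of each spider form a dense graph without cycles of length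
at most `2 * ρ`. -/
lemma exists_input_of_two_le_radius {β ε d : ℝ} {B n k ρ : ℕ} (hβ : 0 < β) (hβ1 : β < 1)
    (hε : ε ≤ 1 / 4) (hk : 1 ≤ k) (hn : 231 ≤ n) (hρ : 2 ≤ ρ)
    (hd : (3 * (ρ : ℝ) - 1) / ((ρ : ℝ) + 1) ≤ d)
    (hd' : d ≤ (1 - β) * (n : ℝ) / (4 * (ρ : ℝ) - 2))
    {A : ComparisonAlgorithm B} (hA : A.Solves n k ρ d ε) :
    ∃ I : BFSInput n, (∀ x, I.id x < n ^ k) ∧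
      ENNReal.ofReal (1 / (3072 * (1 + 4 * B)) *
        (1 / (ρ : ℝ) * ((n : ℝ) / (ρ : ℝ)) ^ (1 + 1 / 2 / (ρ : ℝ)))) ≤
          A.expectedMessages I ρ := by
  have hρR : (2 : ℝ) ≤ ρ := by exact_mod_cast hρ
  have hnR : (231 : ℝ) ≤ n := by exact_mod_cast hn
  have hdn : d * (4 * ρ - 2) ≤ (1 - β) * n := by
    rwa [le_div_iff₀ (by linarith)] at hd'
  have hdl : 3 * ρ - 1 ≤ d * (ρ + 1) := by
    rwa [div_le_iff₀ (by linarith)] at hd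
  have hd1 : 1 ≤ d := by
    by_contra! hlt
    nlinarith
  have hβn : (1 - β) * n ≤ n := by nlinarith
  -- for `n < 11 * ρ` the bounds on `d` are compatible only if `ρ ≤ 21`, hence `n < 231`
  have hnρ : 11 * (ρ : ℝ) ≤ n := by
    by_contra! hlt
    have h1 : (3 * (ρ : ℝ) - 1) * (4 * ρ - 2) ≤ n * (ρ + 1) := by
      calc (3 * (ρ : ℝ) - 1) * (4 * ρ - 2) ≤ d * (ρ + 1) * (4 * ρ - 2) := by
            apply mul_le_mul_of_nonneg_right hdl; linarith
        _ = d * (4 * ρ - 2) * (ρ + 1) := by ring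
        _ ≤ n * (ρ + 1) := by apply mul_le_mul_of_nonneg_right (hdn.trans hβn); linarith
    have h2 : (21 : ℝ) < ρ := by linarith
    nlinarith
  have hnρ' : 11 * ρ ≤ n := by exact_mod_cast hnρ
  -- at least two legs, whose nodes leave more than half of the network to the path and one leg
  set N := n / (8 * ρ) + 1 with hN
  have hN8 : 8 * ρ * (n / (8 * ρ)) ≤ n := Nat.mul_div_le _ _
  have hN8' : n < 8 * ρ * (n / (8 * ρ)) + 8 * ρ := by
    have := Nat.lt_mul_div_succ n (show 0 < 8 * ρ by omega)
    rwa [mul_add, mul_one] at this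
  have hNρ : N * ρ = ρ * (n / (8 * ρ)) + ρ := by rw [hN]; ring
  have hN2 : 2 ≤ N := by
    have : 1 ≤ n / (8 * ρ) := (Nat.one_le_div_iff (by omega)).2 (by omega)
    omega
  set q := ρ * (n / (8 * ρ)) with hq
  have hq8 : 8 * q ≤ n := by rw [hq, ← mul_assoc]; exact hN8
  obtain ⟨L, hL⟩ : ∃ L, n = 2 * (N * ρ) + (L + 1) := ⟨n - 2 * (N * ρ) - 1, by omega⟩
  have hLn : n < 2 * (L + ρ) := by omega
  have hlt : d * ((ρ : ℝ) + 1) < L + ρ := by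
    have h1 : (n : ℝ) < 2 * (L + ρ) := by exact_mod_cast hLn
    have h2 : d * ((ρ : ℝ) + 1) * 2 ≤ d * (4 * ρ - 2) := by nlinarith
    linarith
  obtain ⟨H, hH, hedges⟩ := SimpleGraph.exists_noShortCycle hN2 (show 1 ≤ ρ by omega)
  obtain ⟨I, hid, hI⟩ := SpiderNode.exists_input_card_le hH hL hk (by omega) (by omega) hd1 hlt
    hε hA
  refine ⟨I, hid, le_trans (ENNReal.ofReal_le_ofReal ?_) hI⟩
  have hρ0 : (0 : ℝ) < ρ := by linarith
  have hnN : (n : ℝ) / ρ ≤ 8 * N := by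
    rw [div_le_iff₀ hρ0]
    have : n ≤ 8 * (N * ρ) := by
      rw [hNρ, mul_add, hq, ← mul_assoc]
      exact hN8'.le
    have : (n : ℝ) ≤ 8 * (N * ρ) := by exact_mod_cast this
    linarith
  have hexp : (1 : ℝ) / 2 / ρ ≤ 1 := by
    rw [div_le_one hρ0]
    linarith
  have hpow : ((n : ℝ) / ρ) ^ (1 + 1 / 2 / (ρ : ℝ)) ≤ 64 * (24 * H.edgeFinset.card) := by
    calc ((n : ℝ) / ρ) ^ (1 + 1 / 2 / (ρ : ℝ)) ≤ (8 * N : ℝ) ^ (1 + 1 / 2 / (ρ : ℝ)) :=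
          Real.rpow_le_rpow (by positivity) hnN (by positivity)
      _ = (8 : ℝ) ^ (1 + 1 / 2 / (ρ : ℝ)) * (N : ℝ) ^ (1 + 1 / 2 / (ρ : ℝ)) :=
          Real.mul_rpow (by norm_num) (by positivity)
      _ ≤ 64 * (24 * H.edgeFinset.card) := by
          refine mul_le_mul ?_ hedges (by positivity) (by norm_num)
          calc (8 : ℝ) ^ (1 + 1 / 2 / (ρ : ℝ)) ≤ 8 ^ (2 : ℝ) :=
                Real.rpow_le_rpow_of_exponent_le (by norm_num) (by linarith)
            _ = 64 := by norm_num
  have hm : (0 : ℝ) ≤ H.edgeFinset.card := Nat.cast_nonneg _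
  generalize (H.edgeFinset.card : ℝ) = m at hpow hm ⊢
  have hB : (0 : ℝ) ≤ B := by positivity
  calc 1 / (3072 * (1 + 4 * (B : ℝ))) *
        (1 / (ρ : ℝ) * ((n : ℝ) / (ρ : ℝ)) ^ (1 + 1 / 2 / (ρ : ℝ)))
      ≤ 1 / (3072 * (1 + 4 * (B : ℝ))) * (1 / (ρ : ℝ) * (64 * (24 * m))) := by
        gcongr
    _ = m / (2 * ((1 + 4 * B) * ρ)) := by
        field_simp
        ring
    _ ≤ m / (2 * (1 + 4 * B * ρ)) := by
        gcongr
        nlinarith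

theorem theorem3 :
    ∃ c : ℝ, 0 < c ∧
      ∀ (β ε : ℝ) (B : ℕ), 0 < β → β < 1 → 0 < ε → ε < 1 / 4 →
        ∃ (C : ℝ) (n₀ : ℕ), 0 < C ∧
          ∀ (n ρ k : ℕ) (d : ℝ), n₀ ≤ n → 1 ≤ ρ → 1 ≤ k →
            (3 * (ρ : ℝ) - 1) / ((ρ : ℝ) + 1) ≤ d →
            d ≤ (1 - β) * (n : ℝ) / (4 * (ρ : ℝ) - 2) →
            ∀ A : ComparisonAlgorithm B, A.Solves n k ρ d ε →
              ∃ I : BFSInput n, (∀ x, I.id x < n ^ k) ∧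
                ENNReal.ofReal
                    (C * (1 / (ρ : ℝ) * ((n : ℝ) / (ρ : ℝ)) ^ (1 + c / (ρ : ℝ)))) ≤
                  A.expectedMessages I ρ ∧
                (ρ = 1 → ENNReal.ofReal (C * (n : ℝ) ^ 2) ≤ A.expectedMessages I ρ) := by
  refine ⟨1 / 2, by norm_num, fun β ε B hβ hβ1 _ hε =>
    ⟨β ^ 2 / (3072 * (1 + 4 * B)), max 231 ⌈12 / β⌉₊, by positivity, ?_⟩⟩
  intro n ρ k d hn hρ hk hd hd' A hA
  have hn1 : 231 ≤ n := (le_max_left _ _).trans hn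
  have hn2 : 12 / β ≤ n := (Nat.le_ceil _).trans (by exact_mod_cast (le_max_right _ _).trans hn)
  have hnR : (231 : ℝ) ≤ n := by exact_mod_cast hn1
  rcases hρ.eq_or_lt with rfl | hρ2
  · norm_num at hd hd'
    obtain ⟨I, hid, hI⟩ := exists_input_of_radius_one hβ hβ1 hε.le hk hn2 hd (by linarith) hA
    have hsq : ENNReal.ofReal (β ^ 2 / (3072 * (1 + 4 * B)) * (n : ℝ) ^ 2) ≤
        A.expectedMessages I 1 := by
      refine le_trans (ENNReal.ofReal_le_ofReal ?_) hI
      gcongr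
      norm_num
    refine ⟨I, hid, le_trans (ENNReal.ofReal_le_ofReal ?_) hsq, fun _ => hsq⟩
    refine mul_le_mul_of_nonneg_left ?_ (by positivity)
    rw [Nat.cast_one, div_one, one_mul, div_one, div_one, ← Real.rpow_natCast]
    exact Real.rpow_le_rpow_of_exponent_le (by linarith) (by norm_num)
  · obtain ⟨I, hid, hI⟩ :=
      exists_input_of_two_le_radius hβ hβ1 hε.le hk hn1 hρ2 hd hd' hA
    refine ⟨I, hid, le_trans (ENNReal.ofReal_le_ofReal ?_) hI, fun h => by omega⟩
    refine mul_le_mul_of_nonneg_right ?_ (by positivity)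
    gcongr
    nlinarith
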